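/- Let $M$ be a simple matroid of rank at most three on $[d]=\{1,\dots,d\}$. A line of $M$ is a maximal dependent set of points all of whose three-element subsets are dependent; the degree of a point is the number of lines through it, and $Q_M$ is the set of points of degree at least three. Cactus configurations. A matroid is called a line if it is a uniform matroid $U_{2,n}$ (the independent sets are the sets with at most two elements; $n=1$ is allowed). A simple matroid of rank at most three with $n\ge 3$ lines is called a cycle if its lines can be ordered as $l_1,\dots,l_n$ and there are distinct points $p_1,\dots,p_n$ such that the lines through $p_i$ are exactly $l_i$ and $l_{i+1}$ (with $l_{n+1}=l_1$) and every other point lies on exactly one line. The free gluing of two simple matroids of rank at most three at a point of each is the simple matroid of rank at most three on the disjoint union of the ground sets with the two points identified, whose lines are the lines of the two matroids. A connected cactus configuration is a matroid obtained from a line or a cycle by successively freely gluing lines or cycles. $M$ is a cactus configuration if its restriction to each connected component is a connected cactus configuration, where the connected components are the classes of the equivalence relation on points generated by lying on a common line. Ideals. Let $X=(x_{i,j})$ be a $3\times d$ matrix of indeterminates and write $[a,b,c]\in\mathbb{C}[X]$ for the determinant of its columns $a,b,c$. The realization space $\Gamma_M$ is the set of $\gamma=(\gamma_1,\dots,\gamma_d)\in(\mathbb{C}^3)^d$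 such that, for every $S\subseteq[d]$, $S$ is dependent in $M$ if and only if the family $(\gamma_i)_{i\in S}$ is linearly dependent. The matroid variety $V_M$ is the Zariski closure of $\Gamma_M$, and $I_M=I(V_M)\subseteq\mathbb{C}[X]$. The circuit ideal $I_{\mathcal{C}(M)}$ is generated by all minors of $X$ with column set a circuit $B$ of $M$ and row set any $A\subseteq\{1,2,3\}$ with $|A|=|B|$. The ideal $G_M$ is defined as follows: $X_0$ is the set of brackets $[a,b,c]$ with $\{a,b,c\}$ a circuit of $M$; the set $X_{j+1}$ consists of the polynomials obtained from those in $X_j$ by replacing some (possibly none) of the columns $x$ of $X$, where a column $x$ may be replaced by any vector $$[p_1,p_2,p_3]\,p_4-[p_1,p_2,p_4]\,p_3,$$ with $p_1,p_2\in l_1$ and $p_3,p_4\in l_2$ for two distinct lines $l_1,l_2$ of $M$ containing $x$. The ideals generated by $X_0\subseteq X_1\subseteq\cdots$ form an increasing chain, and $G_M$ is its stable value. Theorem. Let $M$ be a cactus configuration such that $Q_M$ does not contain a cycle, i.e. there are no $k\ge 2$, distinct points $x_1,\dots,x_k\in Q_M$ and distinct lines $l_1,\dots,l_k$ of $M$ with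 $\{x_i,x_{i+1}\}\subseteq l_i$ for all $i$ (where $x_{k+1}=x_1$). Then $$I_M=\sqrt{I_{\mathcal{C}(M)}+G_M}.$$ -/

import Mathlib

namespace CactusMatroid

/-! ### Point-line configurations -/

section Combinatorics

variable {α : Type*}

/-- `M` is simple: it has no loops and no parallel elements. -/
def IsSimple (M : Matroid α) : Prop :=
  (∀ x, ¬ M.IsCircuit {x}) ∧ ∀ x y, ¬ M.IsCircuit {x, y}

/-- A line of `M`: a maximal dependent set all of whose three-element subsets are dependent. -/
def IsLine (M : Matroid α) (l : Set α) : Prop :=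
  Maximal (fun s => M.Dep s ∧ ∀ t ⊆ s, t.encard = 3 → M.Dep t) l

/-- The set of lines of `M` through the point `p`. -/
def linesThrough (M : Matroid α) (p : α) : Set (Set α) :=
  {l | IsLine M l ∧ p ∈ l}

/-- The set `Q_M` of points of degree at least three. -/
def pointsOfDegreeGeThree (M : Matroid α) : Set α :=
  {p | p ∈ M.E ∧ 3 ≤ (linesThrough M p).encard}

/-- `M` is a uniform matroid `U_{2,n}`: the independent sets are the subsets with at most two
elements of the (finite) ground set. -/
def IsLineMatroid (M : Matroid α) : Prop :=
  M.E.Finite ∧ ∀ s ⊆ M.E, M.Indep s ↔ s.encard ≤ 2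

/-- `M` is a cycle: a simple matroid of rank at most three whose lines can be listed without
repetition as `l_1, …, l_n` (cyclically), with distinct points `p_1, …, p_n` such that the lines
through `p_i` are exactly `l_i` and `l_{i+1}`, and all other points lie on exactly one line.
(The case `n = 0` is the empty matroid, and `n = 1, 2` cannot occur: two lines share at most one
point.) -/
def IsCycleMatroid (M : Matroid α) : Prop :=
  M.E.Finite ∧ IsSimple M ∧ M.eRank ≤ 3 ∧
    ∃ n : ℕ, 3 ≤ n ∧ ∃ (p : Fin n → α) (l : Fin n → Set α),
      Function.Injective p ∧ Function.Injective l ∧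
      Set.range l = {s | IsLine M s} ∧
      (∀ i, linesThrough M (p i) = {l i, l (finRotate n i)}) ∧
      ∀ q ∈ M.E, q ∉ Set.range p → (linesThrough M q).encard = 1

/-- `K` is the free gluing of `M` and `N` at the point `P`. The points of `M` and `N` are labelled
such that the two identified points carry the same label `P` and no other label is shared. `K` is
the simple matroid of rank at most three on the union of the ground sets, whose lines are the lines
of `M` and the lines of `N`. -/
def IsFreeGluing (M N : Matroid α) (P : α) (K : Matroid α) : Prop :=
  M.E ∩ N.E = {P} ∧ K.E = M.E ∪ N.E ∧ IsSimple K ∧ K.eRank ≤ 3 ∧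
    ∀ l, IsLine K l ↔ (IsLine M l ∨ IsLine N l)

/-- Connected cactus configurations: the matroids obtained from a line or a cycle by successively
gluing lines or cycles freely. -/
inductive IsConnectedCactus : Matroid α → Prop
  | line {M : Matroid α} (hM : IsLineMatroid M) : IsConnectedCactus M
  | cycle {M : Matroid α} (hM : IsCycleMatroid M) : IsConnectedCactus M
  | glue {M N K : Matroid α} {P : α} (hM : IsConnectedCactus M)
      (hN : IsLineMatroid N ∨ IsCycleMatroid N) (hK : IsFreeGluing M N P K) :
      IsConnectedCactus K

/-- The connected component of the point `p` in the point-line configuration `M`: all points that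
can be reached from `p` through a chain of points in which consecutive ones lie on a common line. -/
def component (M : Matroid α) (p : α) : Set α :=
  {q | q ∈ M.E ∧ Relation.ReflTransGen (fun a b => ∃ l, IsLine M l ∧ a ∈ l ∧ b ∈ l) p q}

/-- Cactus configurations: simple matroids of rank at most three all of whose connected components
are connected cactus configurations. -/
def IsCactus (M : Matroid α) : Prop :=
  IsSimple M ∧ M.eRank ≤ 3 ∧ ∀ p ∈ M.E, IsConnectedCactus (M.restrict (component M p))

/-- The set `X` of points contains a cycle of `M`: there are distinct points `x_1, …, x_k` of `X`
and distinct lines `l_1, …, l_k` of `M` with `x_i, x_{i+1} ∈ l_i` (indices modulo `k`). A single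
point on a line is not a cycle, hence `2 ≤ k`. -/
def ContainsCycle (M : Matroid α) (X : Set α) : Prop :=
  ∃ k : ℕ, 2 ≤ k ∧ ∃ (x : Fin k → α) (l : Fin k → Set α),
    Function.Injective x ∧ Function.Injective l ∧ (∀ i, x i ∈ X) ∧
    ∀ i, IsLine M (l i) ∧ x i ∈ l i ∧ x (finRotate k i) ∈ l i

end Combinatorics

/-! ### The ideals -/

section Ideals

open MvPolynomial

noncomputable section

variable {d : ℕ}

/-- The polynomial ring `ℂ[X]` in the entries of a `3 × d` matrix of indeterminates. -/
abbrev Poly (d : ℕ) : Type := MvPolynomial (Fin 3 × Fin d) ℂ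

/-- The `3 × d` matrix of indeterminates. -/
def genericMatrix (d : ℕ) : Matrix (Fin 3) (Fin d) (Poly d) :=
  Matrix.of fun i j => X (i, j)

/-- The bracket `[a, b, c]`: the determinant of the columns `a, b, c` of the generic matrix. -/
def bracket (a b c : Fin d) : Poly d :=
  ((genericMatrix d).submatrix id ![a, b, c]).det

/-- The realization space `Γ_M`; the vector `γ_j ∈ ℂ³` has the coordinates `γ (i, j)`. -/
def realizationSpace (M : Matroid (Fin d)) : Set (Fin 3 × Fin d → ℂ) :=
  {γ | ∀ s : Set (Fin d), M.Dep s ↔ ¬ LinearIndepOn ℂ (fun (j : Fin d) (i : Fin 3) => γ (i, j)) s}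

/-- The matroid variety `V_M`: the Zariski closure of the realization space. -/
def matroidVariety (M : Matroid (Fin d)) : Set (Fin 3 × Fin d → ℂ) :=
  zeroLocus ℂ (vanishingIdeal ℂ (realizationSpace M))

/-- The matroid ideal `I_M = I(V_M)`. -/
def matroidIdeal (M : Matroid (Fin d)) : Ideal (Poly d) :=
  vanishingIdeal ℂ (matroidVariety M)

/-- The circuit ideal, generated by the minors `[A|B]` of the generic matrix with `B` a circuit of
`M` and `A` a set of `|B|` rows. -/
def circuitIdeal (M : Matroid (Fin d)) : Ideal (Poly d) :=
  Ideal.span {P | ∃ (k : ℕ) (A : Fin k ↪o Fin 3) (B : Fin k ↪o Fin d),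
    M.IsCircuit (Set.range B) ∧ P = ((genericMatrix d).submatrix A B).det}

/-- The vector of polynomials `p₁p₂ ∧ p₃p₄ = [p₁, p₂, p₃] p₄ - [p₁, p₂, p₄] p₃`. -/
def meet (p₁ p₂ p₃ p₄ : Fin d) : Fin 3 → Poly d := fun i =>
  bracket p₁ p₂ p₃ * genericMatrix d i p₄ - bracket p₁ p₂ p₄ * genericMatrix d i p₃

/-- An admissible modification of the variables: each column `x` either is left unchanged or is
replaced by `p₁p₂ ∧ p₃p₄`, where `p₁, p₂ ∈ l₁` and `p₃, p₄ ∈ l₂` for distinct lines `l₁, l₂`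
through `x`. -/
def IsModification (M : Matroid (Fin d)) (σ : Fin d → Fin 3 → Poly d) : Prop :=
  ∀ x, (σ x = fun i => genericMatrix d i x) ∨
    ∃ l₁ l₂ : Set (Fin d), IsLine M l₁ ∧ IsLine M l₂ ∧ l₁ ≠ l₂ ∧ x ∈ l₁ ∧ x ∈ l₂ ∧
      ∃ p₁ p₂ p₃ p₄ : Fin d, p₁ ∈ l₁ ∧ p₂ ∈ l₁ ∧ p₃ ∈ l₂ ∧ p₄ ∈ l₂ ∧ σ x = meet p₁ p₂ p₃ p₄

/-- The sets `X_j` of polynomials: `X_0` consists of the brackets of the circuits of size three, and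
`X_{j+1}` of the polynomials obtained from those in `X_j` by a modification. -/
def grassmannCayleySet (M : Matroid (Fin d)) : ℕ → Set (Poly d)
  | 0 => {P | ∃ a b c : Fin d, a < b ∧ b < c ∧ M.IsCircuit {a, b, c} ∧ P = bracket a b c}
  | j + 1 => {P | ∃ Q ∈ grassmannCayleySet M j, ∃ σ : Fin d → Fin 3 → Poly d,
      IsModification M σ ∧ P = bind₁ (fun v : Fin 3 × Fin d => σ v.2 v.1) Q}

/-- The Grassmann–Cayley ideal `G_M`: the union (stable value) of the increasing chain of the
ideals generated by the sets `X_j`. -/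
def grassmannCayleyIdeal (M : Matroid (Fin d)) : Ideal (Poly d) :=
  ⨆ j, Ideal.span (grassmannCayleySet M j)

end

end Ideals

end CactusMatroid

/-! By the Nullstellensatz it suffices that `Γ_M` and the zero set of `I_C(M) + G_M` have the same
vanishing ideal. The generators vanish on `Γ_M` because in a realization two distinct lines through
`x` meet in a multiple of the vector of `x`; a modification therefore only rescales columns
(`aeval_grassmannCayleySet_eq_zero`).

For the converse, let `γ` be a common zero. It is shown to be a column-by-column rescaling, zero
factors allowed, of a Euclidean limit of realizations, so every polynomial vanishing on `Γ_M`
vanishes at `γ`. The obstacle is zero columns: points and lines must be given nonzero vectors and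
covectors respecting all incidences (`Inc`). The zeros of all Grassmann–Cayley polynomials are
stable under modifications, so a zero column can be replaced by a nonzero meet of two of its lines.
Repetition ends in a family where all such meets vanish (`IsSaturated`). There, the lines through a
zero column whose vectors span a plane all have the same plane, and the planes of the other lines
are partly free. As `Q_M` contains no cycle, its zero points can be removed leaf by leaf, which
permits a choice of planes concurrent at each of them (`IsSaturated.exists_planes`); at points of
degree at most two concurrency is automatic.

The cactus hypothesis says that `Inc` lies in the closure of the generic configurations `Gen`, which
are realizations. This property, `Flexible`, holds for polygons (`polygonInc_subset`), survives
adding a point on at most one line (`Flexible.insert_leaf`, `Flexible.insert_free`) and gluing at a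
point (`Flexible.glue`). In the gluing, shears that fix the common point move one part into general
position relative to the other. -/

namespace CactusMatroid

open Matrix Filter Topology

/-! ### Vector algebra in `ℂ³` -/

/-- Vectors of `ℂ³`. -/
abbrev Vec3 : Type := Fin 3 → ℂ

/-- The triple product, i.e. the determinant of three vectors of `ℂ³`. -/
def tri (a b c : Vec3) : ℂ := a ⬝ᵥ (b ⨯₃ c)

theorem dot_expand (a b : Vec3) : a ⬝ᵥ b = a 0 * b 0 + a 1 * b 1 + a 2 * b 2 := by
  simp [dotProduct, Fin.sum_univ_three]

theorem cross_zero' (a b : Vec3) : (a ⨯₃ b) 0 = a 1 * b 2 - a 2 * b 1 := by simp [cross_apply]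
theorem cross_one' (a b : Vec3) : (a ⨯₃ b) 1 = a 2 * b 0 - a 0 * b 2 := by simp [cross_apply]
theorem cross_two' (a b : Vec3) : (a ⨯₃ b) 2 = a 0 * b 1 - a 1 * b 0 := by simp [cross_apply]

theorem vec3_ext {a b : Vec3} (h0 : a 0 = b 0) (h1 : a 1 = b 1) (h2 : a 2 = b 2) : a = b := by
  funext i; fin_cases i <;> assumption

theorem tri_expand (a b c : Vec3) : tri a b c =
    a 0 * (b 1 * c 2 - b 2 * c 1) + a 1 * (b 2 * c 0 - b 0 * c 2)
      + a 2 * (b 0 * c 1 - b 1 * c 0) := by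
  simp only [tri, dot_expand, cross_zero', cross_one', cross_two']

theorem tri_rotate (a b c : Vec3) : tri a b c = tri b c a := triple_product_permutation a b c

theorem tri_swap (a b c : Vec3) : tri a c b = - tri a b c := by simp only [tri_expand]; ring

theorem tri_swap_left (a b c : Vec3) : tri b a c = - tri a b c := by simp only [tri_expand]; ring

theorem tri_eq_det (a b c : Vec3) : tri a b c = Matrix.det ![a, b, c] :=
  triple_product_eq_det a b c

theorem linearIndependent_iff_tri {a b c : Vec3} :
    LinearIndependent ℂ ![a, b, c] ↔ tri a b c ≠ 0 := by
  rw [tri_eq_det, ← isUnit_iff_ne_zero]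
  exact (Matrix.linearIndependent_rows_iff_isUnit (A := Matrix.of ![a, b, c])).trans
    (Matrix.isUnit_iff_isUnit_det _)

theorem exists_smul_of_cross_eq_zero {x y : Vec3} (hx : x ≠ 0) (h : x ⨯₃ y = 0) :
    ∃ c : ℂ, y = c • x := by
  have h0 := congrFun h 0
  have h1 := congrFun h 1
  have h2 := congrFun h 2
  simp only [cross_zero', cross_one', cross_two', Pi.zero_apply] at h0 h1 h2
  obtain ⟨i, hi⟩ := Function.ne_iff.mp hx
  refine ⟨y i / x i, vec3_ext ?_ ?_ ?_⟩ <;> fin_cases i <;>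
    simp at hi ⊢ <;> field_simp <;>
    first
      | (linear_combination h0)
      | (linear_combination (-1 : ℂ) * h0)
      | (linear_combination h1)
      | (linear_combination (-1 : ℂ) * h1)
      | (linear_combination h2)
      | (linear_combination (-1 : ℂ) * h2)

theorem cross_smul_self (c : ℂ) (x : Vec3) : x ⨯₃ (c • x) = 0 := by
  rw [map_smul, cross_self, smul_zero]

theorem cross_ne_zero_comm {x y : Vec3} (h : x ⨯₃ y ≠ 0) : y ⨯₃ x ≠ 0 := by
  rw [← cross_anticomm]; exact neg_ne_zero.mpr h

theorem right_ne_zero_of_cross {x y : Vec3} (h : x ⨯₃ y ≠ 0) : y ≠ 0 := by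
  rintro rfl; simp at h

theorem exists_dot_ne_zero {w : Vec3} (h : w ≠ 0) : ∃ s : Vec3, s ⬝ᵥ w ≠ 0 := by
  obtain ⟨i, hi⟩ := Function.ne_iff.mp h
  exact ⟨Pi.single i 1, by simpa using hi⟩

theorem exists_smul_cross_of_orth {a b v : Vec3} (h : a ⨯₃ b ≠ 0) (ha : a ⬝ᵥ v = 0)
    (hb : b ⬝ᵥ v = 0) : ∃ c : ℂ, v = c • (a ⨯₃ b) := by
  refine exists_smul_of_cross_eq_zero h ?_
  rw [cross_cross_eq_smul_sub_smul, ha, hb]; simp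

/-- The pairing equals `-(s ⬝ᵥ (P ⨯₃ x))`. The covectors `P ⨯₃ s` annihilate `P`, so this separates
`x` from `P` by such a covector. -/
theorem exists_orth_of_cross {P x : Vec3} (h : P ⨯₃ x ≠ 0) :
    ∃ s : Vec3, (P ⨯₃ s) ⬝ᵥ x ≠ 0 := by
  obtain ⟨s, hs⟩ := exists_dot_ne_zero h
  refine ⟨s, fun h0 => hs ?_⟩
  simp only [dot_expand, cross_zero', cross_one', cross_two'] at h0 ⊢
  linear_combination -h0

theorem exists_orth_ne_zero {a : Vec3} (ha : a ≠ 0) : ∃ s, a ⨯₃ s ≠ 0 := by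
  obtain ⟨i, hi⟩ := Function.ne_iff.mp ha
  -- The coordinate `i + 2` of `a ⨯₃ e_{i+1}` is `a i`, with indices modulo 3.
  refine ⟨Pi.single (i + 1) 1, fun h => hi ?_⟩
  have := congrFun h (i + 2)
  fin_cases i <;> simpa [cross_apply] using this

/-- Any two vectors of `ℂ³` have a common nonzero orthogonal vector. -/
theorem exists_common_orth (a b : Vec3) : ∃ v : Vec3, v ≠ 0 ∧ a ⬝ᵥ v = 0 ∧ b ⬝ᵥ v = 0 := by
  by_cases h : a ⨯₃ b = 0
  · by_cases ha : a = 0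
    · by_cases hb : b = 0
      · exact ⟨Pi.single 0 1, by simp, by simp [ha], by simp [hb]⟩
      · obtain ⟨s, hs⟩ := exists_orth_ne_zero hb
        exact ⟨_, hs, by simp [ha], dot_self_cross _ _⟩
    · obtain ⟨s, hs⟩ := exists_orth_ne_zero ha
      obtain ⟨c, rfl⟩ := exists_smul_of_cross_eq_zero ha h
      exact ⟨_, hs, dot_self_cross _ _, by rw [smul_dotProduct, dot_self_cross, smul_zero]⟩
  · exact ⟨_, h, dot_self_cross _ _, dot_cross_self _ _⟩

theorem cross_ne_zero_of_tri {a b c : Vec3} (h : tri a b c ≠ 0) : a ⨯₃ b ≠ 0 := by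
  intro h0
  rw [tri_rotate, tri_rotate, tri, h0] at h
  simp at h

theorem cross_ne_zero_of_dot {a x y : Vec3} (hx : a ⬝ᵥ x = 0) (hx0 : x ≠ 0) (hy : a ⬝ᵥ y ≠ 0) :
    x ⨯₃ y ≠ 0 := by
  intro h
  obtain ⟨c, rfl⟩ := exists_smul_of_cross_eq_zero hx0 h
  rw [dotProduct_smul, hx, smul_zero] at hy
  exact hy rfl

theorem eq_zero_of_orth_tri {h a b c : Vec3} (ht : tri a b c ≠ 0) (ha : h ⬝ᵥ a = 0)
    (hb : h ⬝ᵥ b = 0) (hc : h ⬝ᵥ c = 0) : h = 0 := by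
  -- Cramer's rule: the three cross products form the dual basis up to the determinant.
  have key : tri a b c • h = (h ⬝ᵥ a) • (b ⨯₃ c) + (h ⬝ᵥ b) • (c ⨯₃ a) + (h ⬝ᵥ c) • (a ⨯₃ b) := by
    refine vec3_ext ?_ ?_ ?_ <;>
    simp only [tri_expand, dot_expand, cross_zero', cross_one', cross_two', Pi.add_apply,
      Pi.smul_apply, smul_eq_mul] <;> ring
  rw [ha, hb, hc] at key
  simpa [ht] using key

theorem tri_eq_zero_of_orth {h a b c : Vec3} (hh : h ≠ 0) (ha : h ⬝ᵥ a = 0)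
    (hb : h ⬝ᵥ b = 0) (hc : h ⬝ᵥ c = 0) : tri a b c = 0 := by
  by_contra ht
  exact hh (eq_zero_of_orth_tri ht ha hb hc)

theorem exists_tri_ne_zero {x y : Vec3} (h : x ⨯₃ y ≠ 0) : ∃ a, tri x y a ≠ 0 := by
  obtain ⟨a, ha⟩ := exists_dot_ne_zero h
  exact ⟨a, by rwa [tri_rotate, tri_rotate, tri]⟩

/-- The orthogonal complement of `y` is not contained in the span of `h`. -/
theorem exists_orth_not_parallel {y h : Vec3} (hy : y ≠ 0) (hh : h ≠ 0) :
    ∃ s : Vec3, h ⨯₃ (y ⨯₃ s) ≠ 0 := by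
  obtain ⟨a, ha⟩ := exists_orth_ne_zero hy
  obtain ⟨b, hb⟩ := exists_tri_ne_zero ha
  by_contra! hn
  obtain ⟨k, hk⟩ := exists_smul_of_cross_eq_zero hh (hn a)
  obtain ⟨m, hm⟩ := exists_smul_of_cross_eq_zero hh (hn b)
  -- For a basis `y, a, b` the vectors `y ⨯₃ a` and `y ⨯₃ b` are independent, so they cannot both be
  -- multiples of `h`.
  have key : (y ⨯₃ a) ⨯₃ (y ⨯₃ b) = tri y a b • y := by
    refine vec3_ext ?_ ?_ ?_ <;>
    simp only [tri_expand, cross_zero', cross_one', cross_two', Pi.smul_apply, smul_eq_mul] <;> ring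
  rw [hk, hm] at key
  simp only [map_smul, LinearMap.smul_apply, cross_self, smul_zero] at key
  exact smul_ne_zero hb hy key.symm

/-! ### Generic parameters -/

section Generic

variable {V W : Type*} [NormedAddCommGroup V] [NormedSpace ℂ V]
  [NormedAddCommGroup W] [NormedSpace ℂ W] [CompleteSpace W]

/-- Restrict to the complex line from `x` to `B`: by the identity theorem, an entire function of one
variable that is nonzero at `1` does not vanish identically near `0`. -/
theorem dense_ne_zero_of_differentiable {F : V → W} (hF : Differentiable ℂ F) {B : V}
    (hB : F B ≠ 0) : Dense {x | F x ≠ 0} := by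
  intro x
  rw [mem_closure_iff_frequently]
  let g : ℂ → V := fun t => x + t • (B - x)
  have hg : Differentiable ℂ g := by fun_prop
  have hFg : Differentiable ℂ (F ∘ g) := hF.comp hg
  have key : ∃ᶠ t in 𝓝 (0 : ℂ), F (g t) ≠ 0 := by
    intro h
    have h' : ∀ᶠ t in 𝓝 (0 : ℂ), (F ∘ g) t = 0 := h.mono fun t ht => by simpa using ht
    have han : AnalyticOnNhd ℂ (F ∘ g) Set.univ := fun z _ => hFg.analyticAt z
    have := han.eqOn_zero_of_preconnected_of_eventuallyEq_zero isPreconnected_univ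
      (Set.mem_univ _) h' (Set.mem_univ (1 : ℂ))
    simp [g] at this
    exact hB this
  have hg0 : Tendsto g (𝓝 0) (𝓝 x) := by
    have := hg.continuous.tendsto 0
    simpa [g] using this
  exact hg0.frequently key

/-- Generic conditions are recorded in the residual filter, where finitely many of them can be
combined; Baire's theorem then makes their conjunction dense. -/
theorem residual_ne_zero {F : V → W} (hF : Differentiable ℂ F)
    (hB : ∃ B, F B ≠ 0) : ∀ᶠ x in residual V, F x ≠ 0 := by
  obtain ⟨B, hB⟩ := hB
  exact residual_of_dense_open (isOpen_ne_fun hF.continuous continuous_const)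
    (dense_ne_zero_of_differentiable hF hB)

end Generic

/-- The value of a continuous family at a parameter is a limit of generic members. -/
theorem mem_closure_of_family {V : Type*} [NormedAddCommGroup V] [CompleteSpace V] {X : Type*} [TopologicalSpace X] {f : V → X}
    {U : Set X} {p : V → Prop} {c : X} {x₀ : V} (hf : ContinuousAt f x₀) (hc : f x₀ = c)
    (hp : ∀ᶠ x in residual V, p x) (hU : ∀ᶠ x in 𝓝 x₀, p x → f x ∈ U) : c ∈ closure U := by
  rw [mem_closure_iff_frequently, ← hc]
  have h1 : ∃ᶠ x in 𝓝 x₀, p x := mem_closure_iff_frequently.mp (dense_of_mem_residual hp x₀)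
  exact hf.tendsto.frequently ((h1.and_eventually hU).mono fun x hx => hx.2 hx.1)

/-- The conditions are imposed one at a time: since those already achieved are open, a small enough
further perturbation keeps them. -/
theorem closure_inter_iInter_of_open {X ι : Type*} [TopologicalSpace X] [Finite ι] {Z : Set X}
    {U : ι → Set X} (hU : ∀ i, IsOpen (U i)) (h : ∀ i, Z ⊆ closure (Z ∩ U i)) :
    Z ⊆ closure (Z ∩ ⋂ i, U i) := by
  have key : ∀ s : Set ι, s.Finite → Z ⊆ closure (Z ∩ ⋂ i ∈ s, U i) := by
    intro s hs
    induction s, hs using Set.Finite.induction_on with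
    | empty => simpa using subset_closure
    | @insert a s _ hs ih =>
      refine ih.trans (closure_minimal ?_ isClosed_closure)
      rintro c ⟨hcZ, hcs⟩
      have ho : IsOpen (⋂ i ∈ s, U i) := hs.isOpen_biInter fun i _ => hU i
      have := h a hcZ
      rw [mem_closure_iff_frequently] at this ⊢
      refine (this.and_eventually (ho.mem_nhds hcs)).mono ?_
      rintro c ⟨⟨h1, h2⟩, h3⟩
      refine ⟨h1, ?_⟩
      rw [Set.biInter_insert]
      exact ⟨h2, h3⟩
  simpa using key Set.univ Set.finite_univ

/-! ### Rank one perturbations of the identity -/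

/-- The linear map `1 + a φᵀ`. -/
def shear (a φ x : Vec3) : Vec3 := x + (φ ⬝ᵥ x) • a

/-- The action of the cofactor matrix of `1 + a φᵀ` on covectors. -/
def coshear (a φ h : Vec3) : Vec3 := (1 + φ ⬝ᵥ a) • h - (h ⬝ᵥ a) • φ

theorem shear_apply (a φ x : Vec3) (i : Fin 3) : shear a φ x i = x i + (φ ⬝ᵥ x) * a i := rfl

theorem coshear_apply (a φ h : Vec3) (i : Fin 3) :
    coshear a φ h i = (1 + φ ⬝ᵥ a) * h i - (h ⬝ᵥ a) * φ i := rfl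

/-- The factor `1 + φ ⬝ᵥ a` is the determinant of `1 + a φᵀ`. When it is nonzero, incidences and
non-incidences are both preserved. -/
theorem coshear_dot_shear (a φ h x : Vec3) :
    coshear a φ h ⬝ᵥ shear a φ x = (1 + φ ⬝ᵥ a) * (h ⬝ᵥ x) := by
  simp only [dot_expand, shear_apply, coshear_apply]; ring

theorem tri_shear (a φ x y z : Vec3) :
    tri (shear a φ x) (shear a φ y) (shear a φ z) = (1 + φ ⬝ᵥ a) * tri x y z := by
  simp only [dot_expand, shear_apply, tri_expand]; ring

theorem cross_shear (a φ x y : Vec3) :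
    shear a φ x ⨯₃ shear a φ y = coshear a φ (x ⨯₃ y) := by
  refine vec3_ext ?_ ?_ ?_ <;>
  simp only [dot_expand, shear_apply, coshear_apply, cross_zero', cross_one', cross_two'] <;> ring

theorem shear_ne_zero {a φ x : Vec3} (h : 1 + φ ⬝ᵥ a ≠ 0) (hx : x ≠ 0) : shear a φ x ≠ 0 := by
  intro h0
  obtain ⟨s, hs⟩ := exists_dot_ne_zero hx
  have := coshear_dot_shear a φ s x
  rw [h0, dotProduct_zero] at this
  exact mul_ne_zero h hs this.symm

theorem coshear_ne_zero {a φ x : Vec3} (h : 1 + φ ⬝ᵥ a ≠ 0) (hx : x ≠ 0) :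
    coshear a φ x ≠ 0 := by
  intro h0
  obtain ⟨s, hs⟩ := exists_dot_ne_zero hx
  have := coshear_dot_shear a φ x s
  rw [h0, zero_dotProduct, dotProduct_comm x s] at this
  exact mul_ne_zero h hs this.symm

@[simp] theorem shear_zero_left (φ x : Vec3) : shear 0 φ x = x := by simp [shear]

@[simp] theorem coshear_zero_left (φ x : Vec3) : coshear 0 φ x = x := by simp [coshear]

/-! ### Flexible incidence structures -/

/-- Assignments of vectors to points and of covectors to lines. -/
abbrev Config (α : Type*) : Type _ := (α → Vec3) × (Set α → Vec3)

variable {α : Type*}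

/-- The assignments of nonzero vectors and covectors respecting the incidences. -/
def Inc (E : Set α) (L : Set (Set α)) : Set (Config α) :=
  {c | (∀ x ∈ E, c.1 x ≠ 0) ∧ (∀ l ∈ L, c.2 l ≠ 0) ∧ ∀ l ∈ L, ∀ x ∈ E, x ∈ l → c.2 l ⬝ᵥ c.1 x = 0}

/-- The assignments with no other dependencies than those forced by the incidences. -/
def Gen (E : Set α) (L : Set (Set α)) : Set (Config α) :=
  {c | c ∈ Inc E L ∧ (∀ x ∈ E, ∀ y ∈ E, x ≠ y → c.1 x ⨯₃ c.1 y ≠ 0) ∧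
    (∀ x ∈ E, ∀ y ∈ E, ∀ z ∈ E, x ≠ y → x ≠ z → y ≠ z →
      (¬ ∃ l ∈ L, x ∈ l ∧ y ∈ l ∧ z ∈ l) → tri (c.1 x) (c.1 y) (c.1 z) ≠ 0) ∧
    ∀ x ∈ E, ∀ l ∈ L, x ∉ l → c.2 l ⬝ᵥ c.1 x ≠ 0}

/-- Every assignment respecting the incidences is a limit of generic ones. -/
def Flexible (E : Set α) (L : Set (Set α)) : Prop := Inc E L ⊆ closure (Gen E L)

theorem Inc.mono {E E' : Set α} {L L' : Set (Set α)} (hE : E' ⊆ E) (hL : L' ⊆ L) :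
    Inc E L ⊆ Inc E' L' := fun _ hc =>
  ⟨fun x hx => hc.1 x (hE hx), fun l hl => hc.2.1 l (hL hl),
    fun l hl x hx => hc.2.2 l (hL hl) x (hE hx)⟩

/-- All conditions in `Gen` concern pairings, cross products and triple products, which transform
under an invertible shear without changing whether they vanish. Values outside `E` and `L` play no
role. -/
theorem shear_mem_gen {E : Set α} {L : Set (Set α)} {c c' : Config α} {a φ : Vec3}
    (h : 1 + φ ⬝ᵥ a ≠ 0) (hc : c ∈ Gen E L) (h1 : ∀ x ∈ E, c'.1 x = shear a φ (c.1 x))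
    (h2 : ∀ l ∈ L, c'.2 l = coshear a φ (c.2 l)) : c' ∈ Gen E L := by
  obtain ⟨⟨i1, i2, i3⟩, g1, g2, g3⟩ := hc
  refine ⟨⟨fun x hx => ?_, fun l hl => ?_, fun l hl x hx hxl => ?_⟩, fun x hx y hy hxy => ?_,
    fun x hx y hy z hz h3 h4 h5 h6 => ?_, fun x hx l hl hxl => ?_⟩
  · rw [h1 x hx]; exact shear_ne_zero h (i1 x hx)
  · rw [h2 l hl]; exact coshear_ne_zero h (i2 l hl)
  · rw [h1 x hx, h2 l hl, coshear_dot_shear, i3 l hl x hx hxl, mul_zero]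
  · rw [h1 x hx, h1 y hy, cross_shear]; exact coshear_ne_zero h (g1 x hx y hy hxy)
  · rw [h1 x hx, h1 y hy, h1 z hz, tri_shear]
    exact mul_ne_zero h (g2 x hx y hy z hz h3 h4 h5 h6)
  · rw [h1 x hx, h2 l hl, coshear_dot_shear]
    exact mul_ne_zero h (g3 x hx l hl hxl)

theorem mem_gen_of_eqOn {E : Set α} {L : Set (Set α)} {c c' : Config α}
    (hc : c ∈ Gen E L) (h1 : ∀ x ∈ E, c'.1 x = c.1 x) (h2 : ∀ l ∈ L, c'.2 l = c.2 l) :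
    c' ∈ Gen E L :=
  shear_mem_gen (a := 0) (φ := 0) (by simp) hc (by simpa using h1) (by simpa using h2)

/-! ### Adding a point on at most one line -/

section Leaf

variable {E : Set α} {L : Set (Set α)} {q : α}

open Classical in
/-- Move the point `q` of a configuration by the vector `u`. -/
noncomputable def movePoint (q : α) (c : Config α) (u : Vec3) : Config α :=
  (Function.update c.1 q (c.1 q + u), c.2)

theorem movePoint_self (c : Config α) (u : Vec3) : (movePoint q c u).1 q = c.1 q + u := by
  simp [movePoint]

theorem movePoint_of_ne (c : Config α) (u : Vec3) {x : α} (hx : x ≠ q) :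
    (movePoint q c u).1 x = c.1 x := by
  simp [movePoint, hx]

theorem movePoint_snd (c : Config α) (u : Vec3) : (movePoint q c u).2 = c.2 := rfl

theorem movePoint_zero (c : Config α) : movePoint q c 0 = c := by
  simp [movePoint]

theorem continuousAt_movePoint {X : Type*} [TopologicalSpace X] {x₀ : X} {f : X → Config α}
    {g : X → Vec3} (hf : ContinuousAt f x₀) (hg : ContinuousAt g x₀) :
    ContinuousAt (fun x => movePoint q (f x) (g x)) x₀ := by
  classical
  unfold movePoint
  refine ContinuousAt.prodMk ?_ hf.snd
  refine continuousAt_pi.mpr fun x => ?_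
  have hfx : ∀ y, ContinuousAt (fun x => (f x).1 y) x₀ := fun y => continuousAt_pi.mp hf.fst y
  by_cases hx : x = q
  · subst hx
    simp only [Function.update_self]
    exact (hfx x).add hg
  · simpa [hx] using hfx x

theorem movePoint_mem_gen (hq : q ∉ E) {c : Config α} (hc : c ∈ Gen E L) (u : Vec3) :
    movePoint q c u ∈ Gen E L :=
  mem_gen_of_eqOn hc (fun x hx => movePoint_of_ne c u (by rintro rfl; exact hq hx)) fun _ _ => rfl

theorem mem_gen_insert {c : Config α} (hc : c ∈ Gen E L) (hc' : c ∈ Inc (insert q E) L)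
    (h1 : ∀ y ∈ E, y ≠ q → c.1 q ⨯₃ c.1 y ≠ 0)
    (h2 : ∀ y ∈ E, ∀ z ∈ E, y ≠ z → (¬ ∃ l ∈ L, q ∈ l ∧ y ∈ l ∧ z ∈ l) → y ≠ q → z ≠ q →
      tri (c.1 q) (c.1 y) (c.1 z) ≠ 0)
    (h3 : ∀ l ∈ L, q ∉ l → c.2 l ⬝ᵥ c.1 q ≠ 0) : c ∈ Gen (insert q E) L := by
  refine ⟨hc', ?_, ?_, ?_⟩
  · rintro x (rfl | hx) y (rfl | hy) hxy
    · exact absurd rfl hxy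
    · exact h1 y hy (Ne.symm hxy)
    · exact cross_ne_zero_comm (h1 x hx hxy)
    · exact hc.2.1 x hx y hy hxy
  · rintro x hx y hy z hz hxy hxz hyz hn
    rcases eq_or_ne x q with rfl | hxq
    · exact h2 y (hy.resolve_left hxy.symm) z (hz.resolve_left hxz.symm) hyz hn hxy.symm hxz.symm
    rcases eq_or_ne y q with rfl | hyq
    · rw [tri_rotate]
      refine h2 z (hz.resolve_left hyz.symm) x (hx.resolve_left hxy) hxz.symm ?_ hyz.symm hxy
      rintro ⟨l, hl, a1, a2, a3⟩
      exact hn ⟨l, hl, a3, a1, a2⟩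
    rcases eq_or_ne z q with rfl | hzq
    · rw [tri_rotate, tri_rotate]
      refine h2 x (hx.resolve_left hxq) y (hy.resolve_left hyq) hxy ?_ hxq hyq
      rintro ⟨l, hl, a1, a2, a3⟩
      exact hn ⟨l, hl, a2, a3, a1⟩
    exact hc.2.2.1 x (hx.resolve_left hxq) y (hy.resolve_left hyq) z (hz.resolve_left hzq)
      hxy hxz hyz hn
  · rintro x (rfl | hx) l hl hxl
    · exact h3 l hl hxl
    · exact hc.2.2.2 x hx l hl hxl

/-- If the point `q` moves in a plane containing it (or freely, if `h = 0`), then its position is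
generic after a small perturbation. -/
theorem mem_closure_gen_insert [Finite α] (hq : q ∉ E) {c : Config α} (hc : c ∈ Gen E L)
    (hc' : c ∈ Inc (insert q E) L) {R : Vec3 → Vec3} (hR : Differentiable ℂ R) (hR0 : R 0 = 0)
    {h : Vec3} (hRl : ∀ l ∈ L, q ∈ l → ∀ s, c.2 l ⬝ᵥ R s = 0)
    (hRh : ∀ ψ : Vec3, ψ ≠ 0 → (h ≠ 0 → h ⨯₃ ψ ≠ 0) → ∃ s, ψ ⬝ᵥ R s ≠ 0)
    (h2 : h ≠ 0 → ∀ y ∈ E, ∀ z ∈ E, (¬ ∃ l ∈ L, q ∈ l ∧ y ∈ l ∧ z ∈ l) →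
      h ⬝ᵥ c.1 y ≠ 0 ∨ h ⬝ᵥ c.1 z ≠ 0)
    (h3 : h ≠ 0 → ∀ l ∈ L, q ∉ l → h ⨯₃ c.2 l ≠ 0) :
    c ∈ closure (Gen (insert q E) L) := by
  have hRi : ∀ i, Differentiable ℂ fun s => R s i := fun i => by fun_prop
  -- Each bad position of `q` will be killed by a fixed covector `ψ` not parallel to `h`. Either the
  -- present position already avoids `ψ`, or the motion `R` leaves its kernel.
  have key : ∀ ψ : Vec3, ψ ≠ 0 → (h ≠ 0 → h ⨯₃ ψ ≠ 0) → ∃ s, ψ ⬝ᵥ (c.1 q + R s) ≠ 0 := by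
    intro ψ h0 h1
    obtain ⟨s, hs⟩ := hRh ψ h0 h1
    by_cases hz : ψ ⬝ᵥ c.1 q = 0
    · exact ⟨s, by rwa [dotProduct_add, hz, zero_add]⟩
    · exact ⟨0, by rwa [hR0, add_zero]⟩
  have r1 : ∀ y ∈ E, y ≠ q → ∀ᶠ s in residual Vec3, (c.1 q + R s) ⨯₃ c.1 y ≠ 0 := by
    intro y hy hyq
    refine residual_ne_zero (F := fun s => (c.1 q + R s) ⨯₃ c.1 y) ?_ ?_
    · refine differentiable_pi.mpr fun i => ?_
      fin_cases i <;> simp [cross_apply] <;> fun_prop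
    have hy0 : c.1 y ≠ 0 := hc.1.1 y hy
    -- A position not killed by a covector `ψ` that annihilates `c.1 y` cannot be parallel to `c.1
    -- y`.
    obtain ⟨ψ, hψy, hψ0, hψh⟩ : ∃ ψ : Vec3, ψ ⬝ᵥ c.1 y = 0 ∧ ψ ≠ 0 ∧ (h ≠ 0 → h ⨯₃ ψ ≠ 0) := by
      by_cases hh : h = 0
      · obtain ⟨s, hs⟩ := exists_orth_ne_zero hy0
        exact ⟨_, by rw [dotProduct_comm]; exact dot_self_cross _ _, hs, fun h' => absurd hh h'⟩
      · obtain ⟨s, hs⟩ := exists_orth_not_parallel hy0 hh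
        exact ⟨_, by rw [dotProduct_comm]; exact dot_self_cross _ _, right_ne_zero_of_cross hs,
          fun _ => hs⟩
    obtain ⟨s, hs⟩ := key ψ hψ0 hψh
    exact ⟨s, cross_ne_zero_comm (cross_ne_zero_of_dot hψy hy0 hs)⟩
  have r2 : ∀ y ∈ E, ∀ z ∈ E, y ≠ z → (¬ ∃ l ∈ L, q ∈ l ∧ y ∈ l ∧ z ∈ l) →
      ∀ᶠ s in residual Vec3, tri (c.1 q + R s) (c.1 y) (c.1 z) ≠ 0 := by
    intro y hy z hz hyz hn
    refine residual_ne_zero (F := fun s => tri (c.1 q + R s) (c.1 y) (c.1 z)) ?_ ?_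
    · simp only [tri_expand, Pi.add_apply]; fun_prop
    have hc0 := hc.2.1 y hy z hz hyz
    -- Here `ψ` is the covector of the plane spanned by `y` and `z`. If it were parallel to `h`,
    -- then `h` would kill both, contrary to `h2`.
    obtain ⟨s, hs⟩ := key _ hc0 fun hh hp => by
      obtain ⟨k, hk⟩ := exists_smul_of_cross_eq_zero hc0 (by rw [← cross_anticomm, hp, neg_zero])
      rcases h2 hh y hy z hz hn with h' | h'
      · rw [hk, smul_dotProduct, dotProduct_comm, dot_self_cross, smul_zero] at h'
        exact h' rfl
      · rw [hk, smul_dotProduct, dotProduct_comm, dot_cross_self, smul_zero] at h'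
        exact h' rfl
    exact ⟨s, by rwa [tri, ← tri, tri, dotProduct_comm]⟩
  have r3 : ∀ l ∈ L, q ∉ l → ∀ᶠ s in residual Vec3, c.2 l ⬝ᵥ (c.1 q + R s) ≠ 0 := by
    intro l hl hql
    refine residual_ne_zero (F := fun s => c.2 l ⬝ᵥ (c.1 q + R s)) ?_ ?_
    · simp only [dot_expand, Pi.add_apply]; fun_prop
    exact key _ (hc.1.2.1 l hl) fun hh => h3 hh l hl hql
  have r : ∀ᶠ s in residual Vec3, (∀ y ∈ E, y ≠ q → (c.1 q + R s) ⨯₃ c.1 y ≠ 0) ∧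
      (∀ y ∈ E, ∀ z ∈ E, y ≠ z → (¬ ∃ l ∈ L, q ∈ l ∧ y ∈ l ∧ z ∈ l) →
        tri (c.1 q + R s) (c.1 y) (c.1 z) ≠ 0) ∧
      ∀ l ∈ L, q ∉ l → c.2 l ⬝ᵥ (c.1 q + R s) ≠ 0 := by
    simp only [Filter.eventually_and, Filter.eventually_all]
    exact ⟨r1, r2, r3⟩
  have hRc : ContinuousAt R 0 := hR.continuous.continuousAt
  have hne : ∀ᶠ s in 𝓝 (0 : Vec3), c.1 q + R s ≠ 0 := by
    have : ContinuousAt (fun s => c.1 q + R s) 0 := continuousAt_const.add hRc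
    refine this.eventually_ne ?_
    rw [hR0, add_zero]
    exact hc'.1 q (Set.mem_insert _ _)
  refine mem_closure_of_family (f := fun s => movePoint q c (R s)) (x₀ := 0)
    (continuousAt_movePoint continuousAt_const hRc) (by rw [hR0, movePoint_zero]) r ?_
  filter_upwards [hne] with s hs ⟨s1, s2, s3⟩
  refine mem_gen_insert (movePoint_mem_gen hq hc _) ⟨?_, hc'.2.1, ?_⟩ ?_ ?_ ?_
  · intro x hx
    by_cases hxq : x = q
    · subst hxq; rwa [movePoint_self]
    · rw [movePoint_of_ne _ _ hxq]; exact hc'.1 x hx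
  · intro l hl x hx hxl
    by_cases hxq : x = q
    · subst hxq
      rw [movePoint_self, movePoint_snd, dotProduct_add, hc'.2.2 l hl x hx hxl, hRl l hl hxl,
        zero_add]
    · rw [movePoint_of_ne _ _ hxq]; exact hc'.2.2 l hl x hx hxl
  · intro y hy hyq
    rw [movePoint_self, movePoint_of_ne _ _ hyq]
    exact s1 y hy hyq
  · intro y hy z hz hyz hn hyq hzq
    rw [movePoint_self, movePoint_of_ne _ _ hyq, movePoint_of_ne _ _ hzq]
    exact s2 y hy z hz hyz hn
  · intro l hl hql
    rw [movePoint_self]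
    exact s3 l hl hql

theorem Flexible.insert_free [Finite α] (hF : Flexible E L) (hq : q ∉ E) (hL : ∀ l ∈ L, q ∉ l) :
    Flexible (insert q E) L := by
  have step : Inc (insert q E) L ⊆ closure (Gen E L ∩ Inc (insert q E) L) := by
    intro c hc
    have h := hF (Inc.mono (Set.subset_insert _ _) le_rfl hc)
    rw [mem_closure_iff_frequently] at h ⊢
    have hne : ∀ᶠ c' in 𝓝 c, c'.1 q ≠ 0 := by
      have : ContinuousAt (fun c' : Config α => c'.1 q) c := by fun_prop
      exact this.eventually_ne (hc.1 q (Set.mem_insert _ _))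
    refine (h.and_eventually hne).mono ?_
    rintro c' ⟨hg, hn⟩
    refine ⟨hg, ?_, hg.1.2.1, ?_⟩
    · rintro x (rfl | hx)
      exacts [hn, hg.1.1 x hx]
    · rintro l hl x (rfl | hx) hxl
      exacts [absurd hxl (hL l hl), hg.1.2.2 l hl x hx hxl]
  refine step.trans (closure_minimal ?_ isClosed_closure)
  rintro c ⟨hc, hc'⟩
  refine mem_closure_gen_insert hq hc hc' (R := id) (h := 0) differentiable_id rfl
    (fun l hl hql => absurd hql (hL l hl)) ?_ (fun h => absurd rfl h) (fun h => absurd rfl h)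
  intro ψ hψ _
  obtain ⟨s, hs⟩ := exists_dot_ne_zero hψ
  exact ⟨s, by rwa [id, dotProduct_comm]⟩

/-- Approximating on `E` may push `q` off the plane of `l₀`; it is projected back and then slid
generically within that plane. By `hsep`, no other line has the same plane as `l₀` in a generic
configuration, so sliding can take `q` off every line not containing it. -/
theorem Flexible.insert_leaf [Finite α] (hF : Flexible E L) (hq : q ∉ E) {l₀ : Set α}
    (hl₀ : l₀ ∈ L) (hql₀ : q ∈ l₀) (huniq : ∀ l ∈ L, q ∈ l → l = l₀)
    (hsep : ∀ l ∈ L, l ≠ l₀ → ∃ x ∈ E, x ∈ l₀ ∧ x ∉ l) :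
    Flexible (insert q E) L := by
  have step : Inc (insert q E) L ⊆ closure (Gen E L ∩ Inc (insert q E) L) := by
    intro c hc
    have h := hF (Inc.mono (Set.subset_insert _ _) le_rfl hc)
    rw [mem_closure_iff_frequently] at h ⊢
    obtain ⟨f, hf⟩ := exists_dot_ne_zero (hc.2.1 l₀ hl₀)
    have hl0q : c.2 l₀ ⬝ᵥ c.1 q = 0 := hc.2.2 l₀ hl₀ q (Set.mem_insert _ _) hql₀
    have hcf : ContinuousAt (fun c' : Config α => f ⬝ᵥ c'.2 l₀) c := by
      simp only [dot_expand]; fun_prop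
    have hcq : ContinuousAt (fun c' : Config α => c'.2 l₀ ⬝ᵥ c'.1 q) c := by
      simp only [dot_expand]; fun_prop
    -- The correction along the fixed direction `f`, transversal to the plane of `l₀`, that returns
    -- `q` to this plane; it vanishes at `c`.
    let u : Config α → Vec3 := fun c' => -((c'.2 l₀ ⬝ᵥ c'.1 q) / (f ⬝ᵥ c'.2 l₀)) • f
    have hu : ContinuousAt u c := ((hcq.div hcf hf).neg).smul continuousAt_const
    have hu0 : u c = 0 := by simp [u, hl0q]
    have hΦ := continuousAt_movePoint (q := q) (f := fun c' => c') continuousAt_id hu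
    have hΦ' : Tendsto (fun c' => movePoint q c' (u c')) (𝓝 c) (𝓝 c) := by
      have := hΦ.tendsto
      rwa [hu0, movePoint_zero] at this
    have hne : ∀ᶠ c' in 𝓝 c, (movePoint q c' (u c')).1 q ≠ 0 := by
      have h1 : ContinuousAt (fun c' : Config α => c'.1 q) c := by fun_prop
      exact (h1.tendsto.comp hΦ').eventually_ne (hc.1 q (Set.mem_insert _ _))
    refine hΦ'.frequently (((h.and_eventually hne).and_eventually (hcf.eventually_ne hf)).mono ?_)
    rintro c' ⟨⟨hg, hn⟩, hf'⟩
    have hg' := movePoint_mem_gen hq hg (u c')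
    refine ⟨hg', ?_, hg'.1.2.1, ?_⟩
    · rintro x (rfl | hx)
      exacts [hn, hg'.1.1 x hx]
    · rintro l hl x (rfl | hx) hxl
      · obtain rfl := huniq l hl hxl
        rw [movePoint_self, movePoint_snd, dotProduct_add, dotProduct_smul,
          dotProduct_comm (c'.2 l) f, smul_eq_mul, neg_mul, div_mul_cancel₀ _ hf', add_neg_cancel]
      · exact hg'.1.2.2 l hl x hx hxl
  refine step.trans (closure_minimal ?_ isClosed_closure)
  rintro c ⟨hc, hc'⟩
  refine mem_closure_gen_insert hq hc hc' (R := fun s => c.2 l₀ ⨯₃ s) (h := c.2 l₀) ?_ (by simp)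
    ?_ ?_ ?_ ?_
  · refine differentiable_pi.mpr fun i => ?_
    fin_cases i <;> simp [cross_apply] <;> fun_prop
  · intro l hl hql s
    obtain rfl := huniq l hl hql
    exact dot_self_cross _ _
  · intro ψ _ h
    obtain ⟨s, hs⟩ := exists_orth_of_cross (h (hc.1.2.1 l₀ hl₀))
    exact ⟨s, by rwa [dotProduct_comm]⟩
  · intro _ y hy z hz hn
    by_contra! h
    refine hn ⟨l₀, hl₀, hql₀, ?_, ?_⟩
    · by_contra hyl; exact hc.2.2.2 y hy l₀ hl₀ hyl h.1
    · by_contra hzl; exact hc.2.2.2 z hz l₀ hl₀ hzl h.2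
  · intro _ l hl hql
    obtain ⟨x, hx, hx0, hxl⟩ := hsep l hl (by rintro rfl; exact hql hql₀)
    intro h
    obtain ⟨k, hk⟩ := exists_smul_of_cross_eq_zero (hc.1.2.1 l₀ hl₀) h
    refine hc.2.2.2 x hx l hl hxl ?_
    rw [hk, smul_dotProduct, hc.1.2.2 l₀ hl₀ x hx hx0, smul_zero]

end Leaf
/-! ### Gluing -/

section Glue

variable {α : Type*} {E₁ E₂ : Set α} {L₁ L₂ : Set (Set α)} {P : α}

open Classical in
/-- Combine `c₁` on `(E₁, L₁)` with the image of `c₂` under `1 + a φᵀ` elsewhere. -/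
noncomputable def glueConfig (E₁ : Set α) (L₁ : Set (Set α)) (c₁ c₂ : Config α) (a φ : Vec3) :
    Config α :=
  (fun x => if x ∈ E₁ then c₁.1 x else shear a φ (c₂.1 x),
    fun l => if l ∈ L₁ then c₁.2 l else coshear a φ (c₂.2 l))

theorem glueConfig_fst_left (c₁ c₂ : Config α) (a φ : Vec3) {x : α} (hx : x ∈ E₁) :
    (glueConfig E₁ L₁ c₁ c₂ a φ).1 x = c₁.1 x := if_pos hx

theorem glueConfig_snd_left (c₁ c₂ : Config α) (a φ : Vec3) {l : Set α} (hl : l ∈ L₁) :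
    (glueConfig E₁ L₁ c₁ c₂ a φ).2 l = c₁.2 l := if_pos hl

theorem glueConfig_fst_right (c₁ c₂ : Config α) (a φ : Vec3) {x : α} (hx : x ∉ E₁) :
    (glueConfig E₁ L₁ c₁ c₂ a φ).1 x = shear a φ (c₂.1 x) := if_neg hx

theorem glueConfig_snd_right (c₁ c₂ : Config α) (a φ : Vec3) {l : Set α} (hl : l ∉ L₁) :
    (glueConfig E₁ L₁ c₁ c₂ a φ).2 l = coshear a φ (c₂.2 l) := if_neg hl

theorem glueConfig_zero (c : Config α) (φ : Vec3) : glueConfig E₁ L₁ c c 0 φ = c := by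
  unfold glueConfig
  ext <;> simp

theorem continuousAt_glueConfig {X : Type*} [TopologicalSpace X] {x₀ : X} {f g : X → Config α}
    {a φ : X → Vec3} (hf : ContinuousAt f x₀) (hg : ContinuousAt g x₀) (ha : ContinuousAt a x₀)
    (hφ : ContinuousAt φ x₀) :
    ContinuousAt (fun x => glueConfig E₁ L₁ (f x) (g x) (a x) (φ x)) x₀ := by
  unfold glueConfig
  have hg1 : ∀ x i, ContinuousAt (fun t => (g t).1 x i) x₀ := fun x i => by fun_prop
  have hg2 : ∀ x i, ContinuousAt (fun t => (g t).2 x i) x₀ := fun x i => by fun_prop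
  have hai : ∀ i, ContinuousAt (fun t => a t i) x₀ := continuousAt_pi.mp ha
  have hφi : ∀ i, ContinuousAt (fun t => φ t i) x₀ := continuousAt_pi.mp hφ
  refine ContinuousAt.prodMk (continuousAt_pi.mpr fun x => ?_) (continuousAt_pi.mpr fun l => ?_)
  · split_ifs
    · fun_prop
    · refine continuousAt_pi.mpr fun i => ?_
      simp only [shear_apply, dot_expand]
      fun_prop
  · split_ifs
    · fun_prop
    · refine continuousAt_pi.mpr fun i => ?_
      simp only [coshear_apply, dot_expand]
      fun_prop

theorem inc_union {c : Config α} (h₁ : c ∈ Inc E₁ L₁) (h₂ : c ∈ Inc E₂ L₂)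
    (hL₁ : ∀ l ∈ L₁, l ⊆ E₁) (hL₂ : ∀ l ∈ L₂, l ⊆ E₂) : c ∈ Inc (E₁ ∪ E₂) (L₁ ∪ L₂) := by
  refine ⟨?_, ?_, ?_⟩
  · rintro x (hx | hx)
    exacts [h₁.1 x hx, h₂.1 x hx]
  · rintro l (hl | hl)
    exacts [h₁.2.1 l hl, h₂.2.1 l hl]
  · rintro l (hl | hl) x - hxl
    exacts [h₁.2.2 l hl x (hL₁ l hl hxl) hxl, h₂.2.2 l hl x (hL₂ l hl hxl) hxl]

/-- Only mixed conditions are new. A mixed triple has two members in one part, where `P` may be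
counted in either part, so `m₁` and `m₂` cover all of them. -/
theorem gen_union {c : Config α} (h₁ : c ∈ Gen E₁ L₁) (h₂ : c ∈ Gen E₂ L₂) (hP : E₁ ∩ E₂ = {P})
    (hL₁ : ∀ l ∈ L₁, l ⊆ E₁) (hL₂ : ∀ l ∈ L₂, l ⊆ E₂)
    (m₁ : ∀ x ∈ E₁, ∀ y ∈ E₁, x ≠ y → ∀ z ∈ E₂, z ≠ P → tri (c.1 x) (c.1 y) (c.1 z) ≠ 0)
    (m₂ : ∀ x ∈ E₁, x ≠ P → ∀ y ∈ E₂, ∀ z ∈ E₂, y ≠ z → tri (c.1 x) (c.1 y) (c.1 z) ≠ 0)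
    (m₃ : ∀ x ∈ E₁, x ≠ P → ∀ l ∈ L₂, c.2 l ⬝ᵥ c.1 x ≠ 0)
    (m₄ : ∀ z ∈ E₂, z ≠ P → ∀ l ∈ L₁, c.2 l ⬝ᵥ c.1 z ≠ 0) :
    c ∈ Gen (E₁ ∪ E₂) (L₁ ∪ L₂) := by
  have hP₁ : P ∈ E₁ := (hP.symm.subset rfl).1
  have hP₂ : P ∈ E₂ := (hP.symm.subset rfl).2
  -- A mixed pair is independent because the triple completed by `P` is.
  have pair : ∀ x ∈ E₁, x ≠ P → ∀ y ∈ E₂, y ≠ P → c.1 x ⨯₃ c.1 y ≠ 0 := by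
    intro x hx hxP y hy hyP
    refine cross_ne_zero_of_tri (c := c.1 P) ?_
    rw [← tri_rotate]
    exact m₁ P hP₁ x hx hxP.symm y hy hyP
  have cases : ∀ x ∈ E₁ ∪ E₂, (x ∈ E₁ ∧ x ≠ P) ∨ (x ∈ E₂ ∧ x ≠ P) ∨ x = P := by
    rintro x hx
    by_cases hxP : x = P
    · exact Or.inr (Or.inr hxP)
    · rcases hx with hx | hx
      exacts [Or.inl ⟨hx, hxP⟩, Or.inr (Or.inl ⟨hx, hxP⟩)]
  have t₁ : ∀ x ∈ E₁, ∀ y ∈ E₁, ∀ z ∈ E₁, x ≠ y → x ≠ z → y ≠ z →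
      (¬ ∃ l ∈ L₁ ∪ L₂, x ∈ l ∧ y ∈ l ∧ z ∈ l) → tri (c.1 x) (c.1 y) (c.1 z) ≠ 0 :=
    fun x hx y hy z hz a1 a2 a3 hn => h₁.2.2.1 x hx y hy z hz a1 a2 a3
      fun ⟨l, hl, h⟩ => hn ⟨l, Or.inl hl, h⟩
  have t₂ : ∀ x ∈ E₂, ∀ y ∈ E₂, ∀ z ∈ E₂, x ≠ y → x ≠ z → y ≠ z →
      (¬ ∃ l ∈ L₁ ∪ L₂, x ∈ l ∧ y ∈ l ∧ z ∈ l) → tri (c.1 x) (c.1 y) (c.1 z) ≠ 0 :=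
    fun x hx y hy z hz a1 a2 a3 hn => h₂.2.2.1 x hx y hy z hz a1 a2 a3
      fun ⟨l, hl, h⟩ => hn ⟨l, Or.inr hl, h⟩
  refine ⟨inc_union h₁.1 h₂.1 hL₁ hL₂, ?_, ?_, ?_⟩
  · intro x hx y hy hxy
    rcases cases x hx with ⟨hx, hxP⟩ | ⟨hx, hxP⟩ | rfl <;>
    rcases cases y hy with ⟨hy, hyP⟩ | ⟨hy, hyP⟩ | rfl
    · exact h₁.2.1 x hx y hy hxy
    · exact pair x hx hxP y hy hyP
    · exact h₁.2.1 x hx y hP₁ hxy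
    · exact cross_ne_zero_comm (pair y hy hyP x hx hxP)
    · exact h₂.2.1 x hx y hy hxy
    · exact h₂.2.1 x hx y hP₂ hxy
    · exact h₁.2.1 x hP₁ y hy hxy
    · exact h₂.2.1 x hP₂ y hy hxy
    · exact absurd rfl hxy
  · intro x hx y hy z hz hxy hxz hyz hn
    rcases cases x hx with ⟨hx, hxP⟩ | ⟨hx, hxP⟩ | rfl <;>
    rcases cases y hy with ⟨hy, hyP⟩ | ⟨hy, hyP⟩ | rfl <;>
    rcases cases z hz with ⟨hz, hzP⟩ | ⟨hz, hzP⟩ | rfl <;>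
    first
      | exact absurd rfl hxy
      | exact absurd rfl hxz
      | exact absurd rfl hyz
      | exact t₁ _ (by assumption) _ (by assumption) _ (by assumption) hxy hxz hyz hn
      | exact t₂ _ (by assumption) _ (by assumption) _ (by assumption) hxy hxz hyz hn
      | exact m₁ _ (by assumption) _ (by assumption) hxy _ (by assumption) (by assumption)
      | exact m₂ _ (by assumption) (by assumption) _ (by assumption) _ (by assumption) hyz
      | (rw [tri_rotate]
         exact m₁ _ (by assumption) _ (by assumption) hyz _ (by assumption) (by assumption))
      | (rw [tri_rotate]
         exact m₂ _ (by assumption) (by assumption) _ (by assumption) _ (by assumption) hxz.symm)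
      | (rw [tri_rotate, tri_rotate]
         exact m₁ _ (by assumption) _ (by assumption) hxz.symm _ (by assumption) (by assumption))
      | (rw [tri_rotate, tri_rotate]
         exact m₂ _ (by assumption) (by assumption) _ (by assumption) _ (by assumption) hxy)
  · intro x hx l hl hxl
    rcases cases x hx with ⟨hx, hxP⟩ | ⟨hx, hxP⟩ | rfl <;> rcases hl with hl | hl
    · exact h₁.2.2.2 x hx l hl hxl
    · exact m₃ x hx hxP l hl
    · exact m₄ x hx hxP l hl
    · exact h₂.2.2.2 x hx l hl hxl
    · exact h₁.2.2.2 x hP₁ l hl hxl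
    · exact h₂.2.2.2 x hP₂ l hl hxl

theorem glueConfig_mem_gen_left {c₁ : Config α} (h₁ : c₁ ∈ Gen E₁ L₁) (c₂ : Config α)
    (a φ : Vec3) : glueConfig E₁ L₁ c₁ c₂ a φ ∈ Gen E₁ L₁ :=
  mem_gen_of_eqOn h₁ (fun _ hx => glueConfig_fst_left _ _ _ _ hx)
    fun _ hl => glueConfig_snd_left _ _ _ _ hl

theorem glueConfig_fst_of_mem_right {c₁ c₂ : Config α} {a φ : Vec3} (hP : E₁ ∩ E₂ = {P})
    (hs : shear a φ (c₂.1 P) = c₁.1 P) {x : α} (hx : x ∈ E₂) :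
    (glueConfig E₁ L₁ c₁ c₂ a φ).1 x = shear a φ (c₂.1 x) := by
  by_cases hx₁ : x ∈ E₁
  · obtain rfl : x = P := hP.subset ⟨hx₁, hx⟩
    rw [glueConfig_fst_left _ _ _ _ hx₁, hs]
  · exact glueConfig_fst_right _ _ _ _ hx₁

theorem glueConfig_mem_gen_right {c₁ c₂ : Config α} {a φ : Vec3} (h₂ : c₂ ∈ Gen E₂ L₂)
    (hP : E₁ ∩ E₂ = {P}) (hL : Disjoint L₁ L₂) (hs : shear a φ (c₂.1 P) = c₁.1 P)
    (h : 1 + φ ⬝ᵥ a ≠ 0) : glueConfig E₁ L₁ c₁ c₂ a φ ∈ Gen E₂ L₂ :=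
  shear_mem_gen h h₂ (fun _ hx => glueConfig_fst_of_mem_right hP hs hx)
    fun _ hl => glueConfig_snd_right _ _ _ _ (Set.disjoint_right.mp hL hl)

/-- Approximating on both parts separately gives two configurations that may disagree at `P`. A
shear close to the identity carries the second position of `P` to the first. -/
theorem mem_closure_gen_inter (hF₁ : Flexible E₁ L₁) (hF₂ : Flexible E₂ L₂)
    (hP : E₁ ∩ E₂ = {P}) (hL : Disjoint L₁ L₂) {c : Config α}
    (hc : c ∈ Inc (E₁ ∪ E₂) (L₁ ∪ L₂)) : c ∈ closure (Gen E₁ L₁ ∩ Gen E₂ L₂) := by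
  have hP₁ : P ∈ E₁ := (hP.symm.subset rfl).1
  have h₁ := hF₁ (Inc.mono Set.subset_union_left Set.subset_union_left hc)
  have h₂ := hF₂ (Inc.mono Set.subset_union_right Set.subset_union_right hc)
  have h : (c, c) ∈ closure (Gen E₁ L₁ ×ˢ Gen E₂ L₂) := by
    rw [closure_prod_eq]; exact ⟨h₁, h₂⟩
  rw [mem_closure_iff_frequently] at h ⊢
  obtain ⟨f, hf⟩ := exists_dot_ne_zero (hc.1 P (Or.inl hP₁))
  -- With this `φ`, normalized to take the value one on the second position of `P`, the shear adds
  -- exactly `a` to it. The determinant is the quotient of the two values of `f` at `P`.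
  let a : Config α × Config α → Vec3 := fun t => t.1.1 P - t.2.1 P
  let φ : Config α × Config α → Vec3 := fun t => (f ⬝ᵥ t.2.1 P)⁻¹ • f
  have ha : ContinuousAt a (c, c) := by
    have : Continuous a := by fun_prop
    exact this.continuousAt
  have hd₁ : ContinuousAt (fun t : Config α × Config α => f ⬝ᵥ t.1.1 P) (c, c) := by
    have : Continuous (fun t : Config α × Config α => f ⬝ᵥ t.1.1 P) := by
      simp only [dot_expand]; fun_prop
    exact this.continuousAt
  have hd₂ : ContinuousAt (fun t : Config α × Config α => f ⬝ᵥ t.2.1 P) (c, c) := by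
    have : Continuous (fun t : Config α × Config α => f ⬝ᵥ t.2.1 P) := by
      simp only [dot_expand]; fun_prop
    exact this.continuousAt
  have hφ : ContinuousAt φ (c, c) := (hd₂.inv₀ hf).smul continuousAt_const
  have hΦ := continuousAt_glueConfig (E₁ := E₁) (L₁ := L₁) (x₀ := (c, c)) (f := Prod.fst)
    (g := Prod.snd) continuousAt_fst continuousAt_snd ha hφ
  have hΦc : glueConfig E₁ L₁ c c (a (c, c)) (φ (c, c)) = c := by
    have : a (c, c) = 0 := sub_self _
    rw [this, glueConfig_zero]
  have hΦ' := hΦ.tendsto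
  simp only [hΦc] at hΦ'
  refine hΦ'.frequently (((h.and_eventually (hd₁.eventually_ne hf)).and_eventually
    (hd₂.eventually_ne hf)).mono ?_)
  rintro ⟨c₁, c₂⟩ ⟨⟨⟨hg₁, hg₂⟩, hn₁⟩, hn₂⟩
  refine ⟨glueConfig_mem_gen_left hg₁ _ _ _, glueConfig_mem_gen_right hg₂ hP hL ?_ ?_⟩
  · simp only [shear, φ, a, smul_dotProduct, smul_eq_mul]
    rw [inv_mul_cancel₀ hn₂, one_smul, add_sub_cancel]
  · simp only [φ, a, smul_dotProduct, dotProduct_sub, smul_eq_mul]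
    have hn₂' : f ⬝ᵥ c₂.1 P ≠ 0 := hn₂
    have hn₁' : f ⬝ᵥ c₁.1 P ≠ 0 := hn₁
    have e : 1 + ((f ⬝ᵥ c₂.1 P)⁻¹ * (f ⬝ᵥ c₁.1 P) - (f ⬝ᵥ c₂.1 P)⁻¹ * (f ⬝ᵥ c₂.1 P)) =
        (f ⬝ᵥ c₂.1 P)⁻¹ * (f ⬝ᵥ c₁.1 P) := by field_simp; ring
    rw [e]
    exact mul_ne_zero (inv_ne_zero hn₂') hn₁'

/-! ### Moving one part by shears that fix the common point -/

theorem tri_shear_right (a φ x y z : Vec3) :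
    tri x y (shear a φ z) = tri x y z + (φ ⬝ᵥ z) * tri x y a := by
  simp only [dot_expand, shear_apply, tri_expand]; ring

theorem tri_shear_right_right (a φ x y z : Vec3) :
    tri x (shear a φ y) (shear a φ z) =
      tri x y z + tri x ((φ ⬝ᵥ z) • y - (φ ⬝ᵥ y) • z) a := by
  simp only [dot_expand, shear_apply, tri_expand, Pi.sub_apply, Pi.smul_apply, smul_eq_mul]; ring

/-- Since `P ⨯₃ t.2` annihilates `P`, these shears fix `P`. This lemma and the next three exhibit,
for each mixed condition of `gen_union`, a parameter at which it holds; for most parameters it then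
holds as well. -/
theorem exists_tri_shear_right {P x y z : Vec3} (hxy : x ⨯₃ y ≠ 0) (hz : P ⨯₃ z ≠ 0) :
    ∃ t : Vec3 × Vec3, tri x y (shear t.1 (P ⨯₃ t.2) z) ≠ 0 := by
  by_cases h : tri x y z = 0
  · obtain ⟨s, hs⟩ := exists_orth_of_cross hz
    obtain ⟨a, ha⟩ := exists_tri_ne_zero hxy
    refine ⟨(a, s), ?_⟩
    rw [tri_shear_right, h, zero_add]
    exact mul_ne_zero hs ha
  · exact ⟨(0, 0), by simpa using h⟩

theorem exists_tri_shear_right_right {P x y z : Vec3} (hx : P ⨯₃ x ≠ 0) (hyz : y ⨯₃ z ≠ 0) :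
    ∃ t : Vec3 × Vec3, tri x (shear t.1 (P ⨯₃ t.2) y) (shear t.1 (P ⨯₃ t.2) z) ≠ 0 := by
  by_cases h : tri x y z = 0
  · obtain ⟨s, hs⟩ := exists_orth_of_cross hx
    set φ := P ⨯₃ s
    -- The vector `w` is the combination of `y` and `z` killed by `φ`, and the sheared determinant
    -- is `tri x y z + tri x w a`. As `φ` does not kill `x`, it is enough that `w ≠ 0`.
    set w := (φ ⬝ᵥ z) • y - (φ ⬝ᵥ y) • z with hw
    have hφw : φ ⬝ᵥ w = 0 := by
      rw [hw, dotProduct_sub, dotProduct_smul, dotProduct_smul]; simp only [smul_eq_mul]; ring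
    have hw0 : w ≠ 0 := by
      intro hw0
      rw [tri] at h
      -- If `φ` killed both `y` and `z`, it would be a multiple of `y ⨯₃ z` and so would kill `x`,
      -- because `tri x y z = 0`.
      have hne : ¬ (φ ⬝ᵥ z = 0 ∧ φ ⬝ᵥ y = 0) := by
        rintro ⟨h1, h2⟩
        obtain ⟨k, hk⟩ := exists_smul_cross_of_orth hyz
          (by rwa [dotProduct_comm]) (show z ⬝ᵥ φ = 0 by rwa [dotProduct_comm])
        rw [hk, smul_dotProduct, dotProduct_comm, h, smul_zero] at hs
        exact hs rfl
      apply hne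
      constructor
      · by_contra h1
        have : w ⨯₃ z = 0 := by rw [hw0]; simp
        rw [hw, map_sub, LinearMap.sub_apply, map_smul, map_smul, LinearMap.smul_apply,
          LinearMap.smul_apply, cross_self, smul_zero, sub_zero] at this
        exact smul_ne_zero h1 hyz this
      · by_contra h1
        have : y ⨯₃ w = 0 := by rw [hw0]; simp
        rw [hw, map_sub, map_smul, map_smul, cross_self, smul_zero, zero_sub, neg_eq_zero] at this
        exact smul_ne_zero h1 hyz this
    obtain ⟨a, ha⟩ := exists_tri_ne_zero (cross_ne_zero_comm (cross_ne_zero_of_dot hφw hw0 hs))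
    refine ⟨(a, s), ?_⟩
    rw [tri_shear_right_right, h, zero_add]
    exact ha
  · exact ⟨(0, 0), by simpa using h⟩

theorem exists_coshear_dot {P x h : Vec3} (hx : P ⨯₃ x ≠ 0) (hh : h ≠ 0) :
    ∃ t : Vec3 × Vec3, coshear t.1 (P ⨯₃ t.2) h ⬝ᵥ x ≠ 0 := by
  by_cases h0 : h ⬝ᵥ x = 0
  · obtain ⟨s, hs⟩ := exists_orth_of_cross hx
    obtain ⟨a, ha⟩ := exists_dot_ne_zero hh
    refine ⟨(a, s), ?_⟩
    rw [coshear, sub_dotProduct, smul_dotProduct, h0, smul_zero, zero_sub, smul_dotProduct,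
      dotProduct_comm]
    exact neg_ne_zero.mpr (mul_ne_zero ha hs)
  · exact ⟨(0, 0), by simpa using h0⟩

theorem exists_dot_shear {P z h : Vec3} (hz : P ⨯₃ z ≠ 0) (hh : h ≠ 0) :
    ∃ t : Vec3 × Vec3, h ⬝ᵥ shear t.1 (P ⨯₃ t.2) z ≠ 0 := by
  by_cases h0 : h ⬝ᵥ z = 0
  · obtain ⟨s, hs⟩ := exists_orth_of_cross hz
    obtain ⟨a, ha⟩ := exists_dot_ne_zero hh
    refine ⟨(a, s), ?_⟩
    rw [shear, dotProduct_add, h0, zero_add, dotProduct_smul, dotProduct_comm h]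
    exact mul_ne_zero hs ha
  · exact ⟨(0, 0), by simpa using h0⟩

/-- After both parts have been made generic, the second is moved by the shears with covector `c.1 P
⨯₃ s`. They fix `P`, contain the identity at parameter `0`, and generically destroy all accidental
dependencies between the parts. -/
theorem Flexible.glue [Finite α] (hF₁ : Flexible E₁ L₁) (hF₂ : Flexible E₂ L₂)
    (hP : E₁ ∩ E₂ = {P}) (hL : Disjoint L₁ L₂)
    (hL₁ : ∀ l ∈ L₁, l ⊆ E₁) (hL₂ : ∀ l ∈ L₂, l ⊆ E₂) : Flexible (E₁ ∪ E₂) (L₁ ∪ L₂) := by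
  have hP₁ : P ∈ E₁ := (hP.symm.subset rfl).1
  have hP₂ : P ∈ E₂ := (hP.symm.subset rfl).2
  refine Set.Subset.trans (fun c hc => mem_closure_gen_inter hF₁ hF₂ hP hL hc)
    (closure_minimal ?_ isClosed_closure)
  rintro c ⟨h₁, h₂⟩
  have hs : ∀ a s : Vec3, shear a (c.1 P ⨯₃ s) (c.1 P) = c.1 P := fun a s => by
    rw [shear, dotProduct_comm, dot_self_cross, zero_smul, add_zero]
  have r₀ : ∀ᶠ t in residual (Vec3 × Vec3), 1 + (c.1 P ⨯₃ t.2) ⬝ᵥ t.1 ≠ 0 := by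
    refine residual_ne_zero (F := fun t : Vec3 × Vec3 => 1 + (c.1 P ⨯₃ t.2) ⬝ᵥ t.1) ?_ ⟨0, by simp⟩
    simp only [dot_expand, cross_zero', cross_one', cross_two']; fun_prop
  have r₁ : ∀ x ∈ E₁, ∀ y ∈ E₁, x ≠ y → ∀ z ∈ E₂, z ≠ P → ∀ᶠ t in residual (Vec3 × Vec3),
      tri (c.1 x) (c.1 y) (shear t.1 (c.1 P ⨯₃ t.2) (c.1 z)) ≠ 0 := by
    intro x hx y hy hxy z hz hzP
    refine residual_ne_zero
      (F := fun t : Vec3 × Vec3 => tri (c.1 x) (c.1 y) (shear t.1 (c.1 P ⨯₃ t.2) (c.1 z))) ?_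
      (exists_tri_shear_right (h₁.2.1 x hx y hy hxy) (h₂.2.1 P hP₂ z hz hzP.symm))
    simp only [tri_expand, shear_apply, dot_expand, cross_zero', cross_one', cross_two']; fun_prop
  have r₂ : ∀ x ∈ E₁, x ≠ P → ∀ y ∈ E₂, ∀ z ∈ E₂, y ≠ z → ∀ᶠ t in residual (Vec3 × Vec3),
      tri (c.1 x) (shear t.1 (c.1 P ⨯₃ t.2) (c.1 y)) (shear t.1 (c.1 P ⨯₃ t.2) (c.1 z)) ≠ 0 := by
    intro x hx hxP y hy z hz hyz
    refine residual_ne_zero (F := fun t : Vec3 × Vec3 =>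
      tri (c.1 x) (shear t.1 (c.1 P ⨯₃ t.2) (c.1 y)) (shear t.1 (c.1 P ⨯₃ t.2) (c.1 z))) ?_
      (exists_tri_shear_right_right (h₁.2.1 P hP₁ x hx hxP.symm) (h₂.2.1 y hy z hz hyz))
    simp only [tri_expand, shear_apply, dot_expand, cross_zero', cross_one', cross_two']; fun_prop
  have r₃ : ∀ x ∈ E₁, x ≠ P → ∀ l ∈ L₂, ∀ᶠ t in residual (Vec3 × Vec3),
      coshear t.1 (c.1 P ⨯₃ t.2) (c.2 l) ⬝ᵥ c.1 x ≠ 0 := by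
    intro x hx hxP l hl
    refine residual_ne_zero
      (F := fun t : Vec3 × Vec3 => coshear t.1 (c.1 P ⨯₃ t.2) (c.2 l) ⬝ᵥ c.1 x) ?_
      (exists_coshear_dot (h₁.2.1 P hP₁ x hx hxP.symm) (h₂.1.2.1 l hl))
    simp only [coshear_apply, dot_expand, cross_zero', cross_one', cross_two']; fun_prop
  have r₄ : ∀ z ∈ E₂, z ≠ P → ∀ l ∈ L₁, ∀ᶠ t in residual (Vec3 × Vec3),
      c.2 l ⬝ᵥ shear t.1 (c.1 P ⨯₃ t.2) (c.1 z) ≠ 0 := by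
    intro z hz hzP l hl
    refine residual_ne_zero
      (F := fun t : Vec3 × Vec3 => c.2 l ⬝ᵥ shear t.1 (c.1 P ⨯₃ t.2) (c.1 z)) ?_
      (exists_dot_shear (h₂.2.1 P hP₂ z hz hzP.symm) (h₁.1.2.1 l hl))
    simp only [shear_apply, dot_expand, cross_zero', cross_one', cross_two']; fun_prop
  simp only [← Filter.eventually_all] at r₁ r₂ r₃ r₄
  have r := r₀.and (r₁.and (r₂.and (r₃.and r₄)))
  have hcont : ContinuousAt (fun t : Vec3 × Vec3 => c.1 P ⨯₃ t.2) 0 := by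
    refine continuousAt_pi.mpr fun i => ?_
    fin_cases i <;> simp [cross_apply] <;> fun_prop
  refine mem_closure_of_family
    (f := fun t : Vec3 × Vec3 => glueConfig E₁ L₁ c c t.1 (c.1 P ⨯₃ t.2)) (x₀ := 0)
    (continuousAt_glueConfig continuousAt_const continuousAt_const continuousAt_fst hcont)
    (glueConfig_zero _ _) r (Eventually.of_forall ?_)
  rintro t ⟨s₀, s₁, s₂, s₃, s₄⟩
  have e₁ : ∀ x ∈ E₁, (glueConfig E₁ L₁ c c t.1 (c.1 P ⨯₃ t.2)).1 x = c.1 x :=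
    fun x hx => glueConfig_fst_left _ _ _ _ hx
  have e₂ : ∀ x ∈ E₂, (glueConfig E₁ L₁ c c t.1 (c.1 P ⨯₃ t.2)).1 x =
      shear t.1 (c.1 P ⨯₃ t.2) (c.1 x) :=
    fun x hx => glueConfig_fst_of_mem_right hP (hs _ _) hx
  refine gen_union (P := P) (glueConfig_mem_gen_left h₁ _ _ _)
    (glueConfig_mem_gen_right h₂ hP hL (hs _ _) s₀) hP hL₁ hL₂ ?_ ?_ ?_ ?_
  · intro x hx y hy hxy z hz hzP
    rw [e₁ x hx, e₁ y hy, e₂ z hz]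
    exact s₁ x hx y hy hxy z hz hzP
  · intro x hx hxP y hy z hz hyz
    rw [e₁ x hx, e₂ y hy, e₂ z hz]
    exact s₂ x hx hxP y hy z hz hyz
  · intro x hx hxP l hl
    rw [e₁ x hx, glueConfig_snd_right _ _ _ _ (Set.disjoint_right.mp hL hl)]
    exact s₃ x hx hxP l hl
  · intro z hz hzP l hl
    rw [e₂ z hz, glueConfig_snd_left _ _ _ _ hl]
    exact s₄ z hz hzP l hl

/-- Adjoining a point `P` of the first part to the second as a free point turns a disjoint union
into a gluing at `P`. -/
theorem Flexible.disjoint_union [Finite α] (hF₁ : Flexible E₁ L₁) (hF₂ : Flexible E₂ L₂)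
    (hP : P ∈ E₁) (hE : Disjoint E₁ E₂) (hL : Disjoint L₁ L₂)
    (hL₁ : ∀ l ∈ L₁, l ⊆ E₁) (hL₂ : ∀ l ∈ L₂, l ⊆ E₂) : Flexible (E₁ ∪ E₂) (L₁ ∪ L₂) := by
  have hP₂ : P ∉ E₂ := Set.disjoint_left.mp hE hP
  have h := hF₁.glue (P := P) (hF₂.insert_free hP₂ fun l hl hPl => hP₂ (hL₂ l hl hPl)) ?_ hL hL₁
    fun l hl => (hL₂ l hl).trans (Set.subset_insert _ _)
  · have e : E₁ ∪ insert P E₂ = E₁ ∪ E₂ := by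
      rw [Set.union_insert, Set.insert_eq_of_mem (Set.mem_union_left _ hP)]
    rwa [e] at h
  · ext x
    constructor
    · rintro ⟨hx, rfl | hx'⟩
      exacts [rfl, absurd hx' (Set.disjoint_left.mp hE hx)]
    · rintro rfl
      exact ⟨hP, Set.mem_insert _ _⟩

end Glue
/-! ### Polygons -/

section Polygon

open Fin.NatCast Fin.CommRing

variable {N : ℕ}

theorem fin_add_one_ne (k : Fin (N + 3)) : k + 1 ≠ k := by
  intro h
  exact one_ne_zero (add_eq_left.mp h)

theorem fin_add_one_add_one_ne (k : Fin (N + 3)) : k + 1 + 1 ≠ k := by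
  intro h
  rw [add_assoc] at h
  have := congrArg Fin.val (add_eq_left.mp h)
  simp [Fin.val_add, Nat.mod_eq_of_lt (show 2 < N + 3 by omega)] at this

/-- Closed polygons: the point `i` lies on the lines `i` and `i + 1`. -/
def PolygonInc (N : ℕ) : Set ((Fin (N + 3) → Vec3) × (Fin (N + 3) → Vec3)) :=
  {c | (∀ i, c.1 i ≠ 0) ∧ (∀ i, c.2 i ≠ 0) ∧ (∀ i, c.2 i ⬝ᵥ c.1 i = 0) ∧
    ∀ i, c.2 (i + 1) ⬝ᵥ c.1 i = 0}

/-- Polygons whose points are in general position. -/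
def PolygonGen (N : ℕ) : Set ((Fin (N + 3) → Vec3) × (Fin (N + 3) → Vec3)) :=
  {c | c ∈ PolygonInc N ∧ ∀ i j k, i ≠ j → i ≠ k → j ≠ k → tri (c.1 i) (c.1 j) (c.1 k) ≠ 0}

variable {c : (Fin (N + 3) → Vec3) × (Fin (N + 3) → Vec3)}

/-- If the two lines through the point `k` coincide, this point can slide in their common plane
while everything else stays fixed. -/
theorem exists_movePoint_polygon (hc : c ∈ PolygonInc N) {k : Fin (N + 3)}
    (hk : c.2 k ⨯₃ c.2 (k + 1) = 0) {w : Vec3} (hw : w ≠ 0) :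
    c ∈ closure {c' | c' ∈ PolygonInc N ∧ w ⨯₃ c'.1 k ≠ 0 ∧ ∀ j ≠ k, c'.1 j = c.1 j} := by
  obtain ⟨h1, h2, h3, h4⟩ := hc
  have hd : Differentiable ℂ fun s => c.1 k + c.2 k ⨯₃ s := by
    refine differentiable_pi.mpr fun i => ?_
    fin_cases i <;> simp [cross_apply] <;> fun_prop
  have r : ∀ᶠ s in residual Vec3, w ⨯₃ (c.1 k + c.2 k ⨯₃ s) ≠ 0 := by
    refine residual_ne_zero (F := fun s => w ⨯₃ (c.1 k + c.2 k ⨯₃ s)) ?_ ?_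
    · refine differentiable_pi.mpr fun i => ?_
      fin_cases i <;> simp [cross_apply] <;> fun_prop
    · by_cases h0 : w ⨯₃ c.1 k = 0
      · obtain ⟨s, hs⟩ := exists_orth_not_parallel (h2 k) hw
        exact ⟨s, by rwa [map_add, h0, zero_add]⟩
      · exact ⟨0, by simpa using h0⟩
  have hne : ∀ᶠ s in 𝓝 (0 : Vec3), c.1 k + c.2 k ⨯₃ s ≠ 0 :=
    hd.continuous.continuousAt.eventually_ne (by simpa using h1 k)
  refine mem_closure_of_family
    (f := fun s => (Function.update c.1 k (c.1 k + c.2 k ⨯₃ s), c.2)) (x₀ := 0) ?_ (by simp) r ?_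
  · exact ((continuous_const.update k hd.continuous).prodMk continuous_const).continuousAt
  filter_upwards [hne] with s hs hr
  refine ⟨⟨fun i => ?_, h2, fun i => ?_, fun i => ?_⟩, by simpa using hr,
    fun j hj => by simp [hj]⟩
  · by_cases hi : i = k
    · subst hi; simpa using hs
    · simpa [hi] using h1 i
  · by_cases hi : i = k
    · subst hi; simp only [Function.update_self]
      rw [dotProduct_add, h3, dot_self_cross, add_zero]
    · simpa [hi] using h3 i
  · by_cases hi : i = k
    · subst hi; simp only [Function.update_self]
      obtain ⟨m, hm⟩ := exists_smul_of_cross_eq_zero (h2 i) hk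
      rw [dotProduct_add, h4, hm, smul_dotProduct, dot_self_cross, smul_zero, add_zero]
    · simpa [hi] using h4 i

/-- Line `k + 1` is rotated about the point `k`, and the point `k + 1` follows as its meet with line
`k + 2`. Since `w` lies on the original line and is not parallel to the point `k`, the rotated line
misses `w` while containing the moved point. -/
theorem exists_rotateLine_polygon (hc : c ∈ PolygonInc N) {k : Fin (N + 3)}
    (hk : c.2 (k + 1) ⨯₃ c.2 (k + 1 + 1) ≠ 0) {w : Vec3} (hw : c.1 k ⨯₃ w ≠ 0)
    (hkw : c.2 (k + 1) ⬝ᵥ w = 0) :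
    c ∈ closure {c' | c' ∈ PolygonInc N ∧ w ⨯₃ c'.1 (k + 1) ≠ 0 ∧
      ∀ j ≠ k + 1, c'.1 j = c.1 j} := by
  obtain ⟨h1, h2, h3, h4⟩ := hc
  obtain ⟨s, hs⟩ := exists_orth_of_cross hw
  obtain ⟨m, hm⟩ := exists_smul_cross_of_orth hk (h3 (k + 1)) (h4 (k + 1))
  set u := c.1 k ⨯₃ s with hu
  have huk : u ⬝ᵥ c.1 k = 0 := by rw [dotProduct_comm]; exact dot_self_cross _ _
  let h : ℂ → Vec3 := fun t => c.2 (k + 1) + t • u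
  let v : ℂ → Vec3 := fun t => m • (h t ⨯₃ c.2 (k + 1 + 1))
  have hh : Continuous h := by fun_prop
  have hv : Continuous v := by
    refine continuous_pi fun i => ?_
    fin_cases i <;> simp [v, h, cross_apply] <;> fun_prop
  have hh0 : h 0 = c.2 (k + 1) := by simp [h]
  have hv0 : v 0 = c.1 (k + 1) := by simp only [v, hh0]; exact hm.symm
  refine mem_closure_of_family (p := fun t : ℂ => t ≠ 0)
    (f := fun t => (Function.update c.1 (k + 1) (v t), Function.update c.2 (k + 1) (h t)))
    (x₀ := 0) ?_ (by simp [hh0, hv0])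
    (residual_ne_zero (F := id) differentiable_id ⟨1, one_ne_zero⟩) ?_
  · exact ((continuous_const.update _ hv).prodMk (continuous_const.update _ hh)).continuousAt
  filter_upwards [hh.continuousAt.eventually_ne (show h 0 ≠ 0 by rw [hh0]; exact h2 _),
    hv.continuousAt.eventually_ne (show v 0 ≠ 0 by rw [hv0]; exact h1 _)] with t ht hvt ht0
  have e1 := fin_add_one_ne k
  refine ⟨⟨fun i => ?_, fun i => ?_, fun i => ?_, fun i => ?_⟩, ?_, fun j hj => by simp [hj]⟩
  · by_cases hi : i = k + 1
    · subst hi; simpa using hvt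
    · simpa [hi] using h1 i
  · by_cases hi : i = k + 1
    · subst hi; simpa using ht
    · simpa [hi] using h2 i
  · by_cases hi : i = k + 1
    · subst hi
      simp only [Function.update_self, v]
      rw [dotProduct_smul, dot_self_cross, smul_zero]
    · simpa [hi] using h3 i
  · by_cases hi : i = k + 1
    · subst hi
      simp only [Function.update_self, v, Function.update_of_ne (fin_add_one_ne (k + 1))]
      rw [dotProduct_smul, dot_cross_self, smul_zero]
    · by_cases hik : i = k
      · subst hik
        simp only [Function.update_self, Function.update_of_ne hi, h]
        rw [add_dotProduct, h4, smul_dotProduct, huk, smul_zero, add_zero]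
      · have : i + 1 ≠ k + 1 := fun h => hik (add_right_cancel h)
        simpa [hi, this] using h4 i
  · simp only [Function.update_self]
    refine cross_ne_zero_comm (cross_ne_zero_of_dot (a := h t) ?_ hvt ?_)
    · simp only [v]; rw [dotProduct_smul, dot_self_cross, smul_zero]
    · simp only [h]
      rw [add_dotProduct, hkw, zero_add, smul_dotProduct]
      exact mul_ne_zero ht0 hs

/-- If the point `k + 2` lies on line `k + 1`, this line is tilted off it. Both corners `k` and `k +
1` of the tilted line follow as its meets with the unchanged neighbouring lines. -/
theorem exists_rotateLine_polygon' (hc : c ∈ PolygonInc N) {k : Fin (N + 3)}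
    (hk₀ : c.2 k ⨯₃ c.2 (k + 1) ≠ 0)
    (hk : c.2 (k + 1) ⨯₃ c.2 (k + 1 + 1) ≠ 0) :
    c ∈ closure {c' | c' ∈ PolygonInc N ∧ c'.1 (k + 1 + 1) ⨯₃ c'.1 (k + 1) ≠ 0} := by
  have hc' := hc
  obtain ⟨h1, h2, h3, h4⟩ := hc
  by_cases hkw : c.2 (k + 1) ⬝ᵥ c.1 (k + 1 + 1) = 0
  swap
  · exact subset_closure ⟨hc', cross_ne_zero_comm (cross_ne_zero_of_dot (h3 _) (h1 _) hkw)⟩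
  obtain ⟨u, hu⟩ := exists_dot_ne_zero (h1 (k + 1 + 1))
  obtain ⟨m, hm⟩ := exists_smul_cross_of_orth hk (h3 (k + 1)) (h4 (k + 1))
  obtain ⟨m', hm'⟩ := exists_smul_cross_of_orth hk₀ (h3 k) (h4 k)
  let h : ℂ → Vec3 := fun t => c.2 (k + 1) + t • u
  let v : ℂ → Vec3 := fun t => m • (h t ⨯₃ c.2 (k + 1 + 1))
  let v' : ℂ → Vec3 := fun t => m' • (c.2 k ⨯₃ h t)
  have hh : Continuous h := by fun_prop
  have hv : Continuous v := by
    refine continuous_pi fun i => ?_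
    fin_cases i <;> simp [v, h, cross_apply] <;> fun_prop
  have hv' : Continuous v' := by
    refine continuous_pi fun i => ?_
    fin_cases i <;> simp [v', h, cross_apply] <;> fun_prop
  have hh0 : h 0 = c.2 (k + 1) := by simp [h]
  have hv0 : v 0 = c.1 (k + 1) := by simp only [v, hh0]; exact hm.symm
  have hv'0 : v' 0 = c.1 k := by simp only [v', hh0]; exact hm'.symm
  refine mem_closure_of_family (p := fun t : ℂ => t ≠ 0)
    (f := fun t => (Function.update (Function.update c.1 (k + 1) (v t)) k (v' t),
      Function.update c.2 (k + 1) (h t)))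
    (x₀ := 0) ?_ (by simp [hh0, hv0, hv'0])
    (residual_ne_zero (F := id) differentiable_id ⟨1, one_ne_zero⟩) ?_
  · exact (((continuous_const.update _ hv).update _ hv').prodMk
      (continuous_const.update _ hh)).continuousAt
  filter_upwards [hh.continuousAt.eventually_ne (show h 0 ≠ 0 by rw [hh0]; exact h2 _),
    hv.continuousAt.eventually_ne (show v 0 ≠ 0 by rw [hv0]; exact h1 _),
    hv'.continuousAt.eventually_ne (show v' 0 ≠ 0 by rw [hv'0]; exact h1 _)] with t ht hvt hvt' ht0
  have e1 := fin_add_one_ne k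
  have e2 := fin_add_one_ne (k + 1)
  have e3 := fin_add_one_add_one_ne k
  refine ⟨⟨fun i => ?_, fun i => ?_, fun i => ?_, fun i => ?_⟩, ?_⟩
  · by_cases hik : i = k
    · subst hik; simpa using hvt'
    by_cases hi : i = k + 1
    · subst hi; simpa [e1] using hvt
    · simpa [hi, hik] using h1 i
  · by_cases hi : i = k + 1
    · subst hi; simpa using ht
    · simpa [hi] using h2 i
  · by_cases hik : i = k
    · subst hik
      simp only [Function.update_self, Function.update_of_ne e1.symm, v']
      rw [dotProduct_smul, dot_self_cross, smul_zero]
    by_cases hi : i = k + 1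
    · subst hi
      simp only [Function.update_self, Function.update_of_ne e1, v]
      rw [dotProduct_smul, dot_self_cross, smul_zero]
    · simpa [hi, hik] using h3 i
  · by_cases hik : i = k
    · subst hik
      simp only [Function.update_self, v']
      rw [dotProduct_smul, dot_cross_self, smul_zero]
    by_cases hi : i = k + 1
    · subst hi
      simp only [Function.update_self, Function.update_of_ne e1, Function.update_of_ne e2, v]
      rw [dotProduct_smul, dot_cross_self, smul_zero]
    · have : i + 1 ≠ k + 1 := fun h => hik (add_right_cancel h)
      simpa [hi, hik, this] using h4 i
  · simp only [Function.update_self, Function.update_of_ne e1, Function.update_of_ne e2,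
      Function.update_of_ne e3]
    refine cross_ne_zero_comm (cross_ne_zero_of_dot (a := h t) ?_ hvt ?_)
    · simp only [v]; rw [dotProduct_smul, dot_self_cross, smul_zero]
    · simp only [h]
      rw [add_dotProduct, hkw, zero_add, smul_dotProduct]
      exact mul_ne_zero ht0 hu

theorem fin_add_natCast_ne (z : Fin (N + 3)) {r : ℕ} (h1 : 1 ≤ r) (h2 : r ≤ N + 2) :
    z + (r : Fin (N + 3)) ≠ z := by
  intro h
  have := add_eq_left.mp h
  rw [Fin.natCast_eq_zero] at this
  have := Nat.le_of_dvd (by omega) this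
  omega

theorem fin_succ_add_natCast (i : Fin (N + 3)) : i + 1 + ((N + 2 : ℕ) : Fin (N + 3)) = i := by
  have : (1 : Fin (N + 3)) + ((N + 2 : ℕ) : Fin (N + 3)) = 0 := by
    rw [← Nat.cast_one, ← Nat.cast_add, Fin.natCast_eq_zero]
    exact ⟨1, by ring⟩
  rw [add_assoc, this, add_zero]

/-- Being different from the point `z` is passed around the polygon from one corner to the next, up
to `z + (N + 2) = z - 1`. Each step moves only the next corner, by sliding if its two lines coincide
and by rotating a line otherwise; `m` counts the remaining steps. -/
theorem polygon_propagate (z : Fin (N + 3)) (m : ℕ) : ∀ r : ℕ, 1 ≤ r → r + m = N + 2 →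
    ∀ c ∈ PolygonInc N, c.1 z ⨯₃ c.1 (z + (r : Fin (N + 3))) ≠ 0 →
      c ∈ closure {c' | c' ∈ PolygonInc N ∧
        c'.1 z ⨯₃ c'.1 (z + ((N + 2 : ℕ) : Fin (N + 3))) ≠ 0} := by
  induction m with
  | zero =>
    rintro r h1 hr c hc hz
    obtain rfl : r = N + 2 := by omega
    exact subset_closure ⟨hc, hz⟩
  | succ m ih =>
    intro r h1 hr c hc hz
    have hk : z + ((r + 1 : ℕ) : Fin (N + 3)) = z + (r : Fin (N + 3)) + 1 := by
      push_cast; rw [add_assoc]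
    have hzk : z ≠ z + (r : Fin (N + 3)) + 1 := by
      rw [← hk]; exact (fin_add_natCast_ne z (by omega) (by omega)).symm
    have ih' := ih (r + 1) (by omega) (by omega)
    rw [hk] at ih'
    set k := z + (r : Fin (N + 3)) with hkdef
    have finish : c ∈ closure {c' | c' ∈ PolygonInc N ∧ c.1 z ⨯₃ c'.1 (k + 1) ≠ 0 ∧
        ∀ j ≠ k + 1, c'.1 j = c.1 j} → c ∈ closure {c' | c' ∈ PolygonInc N ∧
        c'.1 z ⨯₃ c'.1 (z + ((N + 2 : ℕ) : Fin (N + 3))) ≠ 0} := by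
      intro h
      refine closure_minimal ?_ isClosed_closure h
      rintro c' ⟨hc', hn, he⟩
      exact ih' c' hc' (by rwa [he z hzk])
    by_cases hz' : c.1 z ⨯₃ c.1 (k + 1) = 0
    · by_cases hkk : c.2 (k + 1) ⨯₃ c.2 (k + 1 + 1) = 0
      · exact finish (exists_movePoint_polygon hc hkk (hc.1 z))
      · refine finish (exists_rotateLine_polygon hc hkk (cross_ne_zero_comm hz) ?_)
        -- The point `z` is parallel to the point `k + 1` here, hence lies on line `k + 1`.
        obtain ⟨a, ha⟩ := exists_smul_of_cross_eq_zero (hc.1 (k + 1))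
          (by rw [← cross_anticomm, hz', neg_zero] : c.1 (k + 1) ⨯₃ c.1 z = 0)
        rw [ha, dotProduct_smul, hc.2.2.1, smul_zero]
    · exact ih' c hc hz'

/-- If consecutive lines are always distinct, tilting one line separates the two points. Otherwise a
corner on two coincident lines can slide away from the point `i + 1`, and the separation propagates
around to `i`; if that corner is `i + 1` itself, it slides away from `i`. -/
theorem polygon_adjacent (hc : c ∈ PolygonInc N) (i : Fin (N + 3)) :
    c ∈ closure (PolygonInc N ∩ {c' | c'.1 (i + 1) ⨯₃ c'.1 i ≠ 0}) := by
  by_cases hA : ∀ k, c.2 k ⨯₃ c.2 (k + 1) ≠ 0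
  · have := exists_rotateLine_polygon' hc (hA (i - 1)) (hA (i - 1 + 1))
    rwa [sub_add_cancel] at this
  push Not at hA
  obtain ⟨k, hk⟩ := hA
  by_cases hki : k = i + 1
  · subst hki
    refine closure_mono ?_ (exists_movePoint_polygon hc hk (hc.1 i))
    rintro c' ⟨h1, h2, h3⟩
    refine ⟨h1, cross_ne_zero_comm ?_⟩
    rwa [h3 i (fin_add_one_ne i).symm]
  · refine closure_minimal ?_ isClosed_closure (exists_movePoint_polygon hc hk (hc.1 (i + 1)))
    rintro c' ⟨h1, h2, h3⟩
    have hr : i + 1 + (((k - (i + 1)).val : ℕ) : Fin (N + 3)) = k := by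
      rw [Fin.cast_val_eq_self, add_sub_cancel]
    have hr1 : 1 ≤ (k - (i + 1)).val := by
      rw [Nat.one_le_iff_ne_zero, Ne, Fin.val_eq_zero_iff, sub_eq_zero]
      exact hki
    have hr2 : (k - (i + 1)).val ≤ N + 2 := by omega
    have := polygon_propagate (i + 1) (N + 2 - (k - (i + 1)).val) (k - (i + 1)).val hr1
      (by omega) c' h1 (by rw [hr, h3 _ (Ne.symm hki)]; exact h2)
    rwa [fin_succ_add_natCast] at this

/-- Once adjacent corners are independent, every line is determined by its two corners. The corners
can then move independently and the lines follow, with the scalars `m` held fixed. -/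
theorem polygonInc_subset : PolygonInc N ⊆ closure (PolygonGen N) := by
  have ho : ∀ i : Fin (N + 3), IsOpen {c : (Fin (N + 3) → Vec3) × (Fin (N + 3) → Vec3) |
      c.1 (i + 1) ⨯₃ c.1 i ≠ 0} := by
    intro i
    refine isOpen_ne_fun (continuous_pi fun j => ?_) continuous_const
    fin_cases j <;> simp [cross_apply] <;> fun_prop
  refine (closure_inter_iInter_of_open ho fun i c hc => polygon_adjacent hc i).trans
    (closure_minimal ?_ isClosed_closure)
  rintro c ⟨⟨h1, h2, h3, h4⟩, hadj⟩
  simp only [Set.mem_iInter, Set.mem_ofPred_eq] at hadj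
  have hm : ∀ i, ∃ m : ℂ, c.2 (i + 1) = m • (c.1 (i + 1) ⨯₃ c.1 i) := fun i =>
    exists_smul_cross_of_orth (hadj i) (by rw [dotProduct_comm]; exact h3 _)
      (by rw [dotProduct_comm]; exact h4 _)
  choose m hm using hm
  have hm0 : ∀ i, m i ≠ 0 := by
    intro i h0
    have := hm i
    rw [h0, zero_smul] at this
    exact h2 _ this
  let v : (Fin (N + 3) → Vec3) → Fin (N + 3) → Vec3 := fun w i => c.1 i + w i
  let h : (Fin (N + 3) → Vec3) → Fin (N + 3) → Vec3 := fun w j =>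
    m (j - 1) • (v w j ⨯₃ v w (j - 1))
  have hv : Continuous v := by fun_prop
  have hh : Continuous h := by
    refine continuous_pi fun j => continuous_pi fun i => ?_
    fin_cases i <;> simp [h, v, cross_apply] <;> fun_prop
  have hv0 : v 0 = c.1 := by funext i; simp [v]
  have hh0 : h 0 = c.2 := by
    funext j
    have := hm (j - 1)
    rw [sub_add_cancel] at this
    simp only [h, hv0]
    exact this.symm
  have r : ∀ i j k, i ≠ j → i ≠ k → j ≠ k → ∀ᶠ w in residual (Fin (N + 3) → Vec3),
      tri (v w i) (v w j) (v w k) ≠ 0 := by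
    intro i j k hij hik hjk
    refine residual_ne_zero (F := fun w => tri (v w i) (v w j) (v w k)) ?_ ?_
    · simp only [v, tri_expand, Pi.add_apply]; fun_prop
    -- The displacement that sends the three chosen corners to the standard basis.
    · refine ⟨fun x => (if x = i then Pi.single 0 1 else if x = j then Pi.single 1 1 else
        Pi.single 2 1) - c.1 x, ?_⟩
      simp [v, hij.symm, hik.symm, hjk.symm, tri_expand]
  simp only [← Filter.eventually_all] at r
  refine mem_closure_of_family (f := fun w => (v w, h w)) (x₀ := 0)
    (hv.prodMk hh).continuousAt (by simp only [hv0, hh0]) r ?_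
  have ev : ∀ᶠ w in 𝓝 (0 : Fin (N + 3) → Vec3), ∀ i, v w i ≠ 0 ∧ h w i ≠ 0 := by
    refine Filter.eventually_all.mpr fun i => ?_
    have c1 : Continuous fun w => v w i := by fun_prop
    have c2 : Continuous fun w => h w i := by fun_prop
    exact (c1.continuousAt.eventually_ne (by rw [hv0]; exact h1 i)).and
      (c2.continuousAt.eventually_ne (by rw [hh0]; exact h2 i))
  filter_upwards [ev] with w hw hr
  refine ⟨⟨fun i => (hw i).1, fun i => (hw i).2, fun i => ?_, fun i => ?_⟩, hr⟩
  · simp only [h]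
    rw [smul_dotProduct, dotProduct_comm, dot_self_cross, smul_zero]
  · simp only [h]
    rw [add_sub_cancel_right, smul_dotProduct, dotProduct_comm, dot_cross_self, smul_zero]

theorem exists_third (i j : Fin (N + 3)) : ∃ k, i ≠ k ∧ j ≠ k := by
  have : ({i, j} : Finset (Fin (N + 3))).card < (Finset.univ : Finset (Fin (N + 3))).card := by
    refine lt_of_le_of_lt Finset.card_le_two ?_
    simp
  obtain ⟨k, -, hk⟩ := Finset.exists_mem_notMem_of_card_lt_card this
  simp only [Finset.mem_insert, Finset.mem_singleton, not_or] at hk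
  exact ⟨k, Ne.symm hk.1, Ne.symm hk.2⟩

theorem flexible_polygon {α : Type*} {p : Fin (N + 3) → α} {l : Fin (N + 3) → Set α}
    (hp : Function.Injective p) (hl : Function.Injective l)
    (hpl : ∀ i j, p i ∈ l j ↔ j = i ∨ j = i + 1) : Flexible (Set.range p) (Set.range l) := by
  intro c hc
  obtain ⟨h1, h2, h3⟩ := hc
  have hb : ((c.1 ∘ p, c.2 ∘ l) : (Fin (N + 3) → Vec3) × (Fin (N + 3) → Vec3)) ∈ PolygonInc N :=
    ⟨fun i => h1 _ ⟨i, rfl⟩, fun i => h2 _ ⟨i, rfl⟩,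
      fun i => h3 _ ⟨i, rfl⟩ _ ⟨i, rfl⟩ ((hpl i i).mpr (Or.inl rfl)),
      fun i => h3 _ ⟨i + 1, rfl⟩ _ ⟨i, rfl⟩ ((hpl i (i + 1)).mpr (Or.inr rfl))⟩
  let f : (Fin (N + 3) → Vec3) × (Fin (N + 3) → Vec3) → Config α := fun b =>
    (Function.extend p b.1 c.1, Function.extend l b.2 c.2)
  have hf : Continuous f := by
    refine Continuous.prodMk (continuous_pi fun x => ?_) (continuous_pi fun x => ?_)
    · by_cases hx : ∃ i, p i = x
      · obtain ⟨i, rfl⟩ := hx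
        simp only [hp.extend_apply]; fun_prop
      · simp only [Function.extend_apply' _ _ _ hx]; fun_prop
    · by_cases hx : ∃ i, l i = x
      · obtain ⟨i, rfl⟩ := hx
        simp only [hl.extend_apply]; fun_prop
      · simp only [Function.extend_apply' _ _ _ hx]; fun_prop
  have hfc : f (c.1 ∘ p, c.2 ∘ l) = c := by
    refine Prod.ext (funext fun x => ?_) (funext fun x => ?_)
    · by_cases hx : ∃ i, p i = x
      · obtain ⟨i, rfl⟩ := hx
        simp [f, hp.extend_apply]
      · simp [f, Function.extend_apply' _ _ _ hx]
    · by_cases hx : ∃ i, l i = x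
      · obtain ⟨i, rfl⟩ := hx
        simp [f, hl.extend_apply]
      · simp [f, Function.extend_apply' _ _ _ hx]
  rw [← hfc]
  refine map_mem_closure hf (polygonInc_subset hb) ?_
  rintro b ⟨⟨b1, b2, b3, b4⟩, bt⟩
  have e1 : ∀ i, (f b).1 (p i) = b.1 i := fun i => hp.extend_apply _ _ _
  have e2 : ∀ i, (f b).2 (l i) = b.2 i := fun i => hl.extend_apply _ _ _
  refine ⟨⟨?_, ?_, ?_⟩, ?_, ?_, ?_⟩
  · rintro _ ⟨i, rfl⟩; rw [e1]; exact b1 i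
  · rintro _ ⟨i, rfl⟩; rw [e2]; exact b2 i
  · rintro _ ⟨j, rfl⟩ _ ⟨i, rfl⟩ hij
    rw [e1, e2]
    rcases (hpl i j).mp hij with rfl | rfl
    exacts [b3 _, b4 _]
  · rintro _ ⟨i, rfl⟩ _ ⟨j, rfl⟩ hij
    rw [e1, e1]
    obtain ⟨k, hik, hjk⟩ := exists_third i j
    exact cross_ne_zero_of_tri (bt i j k (fun h => hij (h ▸ rfl)) hik hjk)
  · rintro _ ⟨i, rfl⟩ _ ⟨j, rfl⟩ _ ⟨k, rfl⟩ hij hik hjk -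
    rw [e1, e1, e1]
    exact bt i j k (fun h => hij (h ▸ rfl)) (fun h => hik (h ▸ rfl)) (fun h => hjk (h ▸ rfl))
  · rintro _ ⟨i, rfl⟩ _ ⟨j, rfl⟩ hij h0
    rw [e1, e2] at h0
    -- A line through a third corner besides its own two would be orthogonal to a basis.
    obtain ⟨k, rfl⟩ : ∃ k, j = k + 1 := ⟨j - 1, (sub_add_cancel _ _).symm⟩
    rw [hpl, not_or] at hij
    exact b2 (k + 1) (eq_zero_of_orth_tri (bt k (k + 1) i (fin_add_one_ne k).symm
      (fun h => hij.2 (h ▸ rfl)) hij.1) (b4 k) (b3 (k + 1)) h0)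

end Polygon
/-! ### Lines of simple matroids -/

section Lines

variable {α : Type*} {M : Matroid α} {l l' s : Set α}

theorem IsLine.dep (h : IsLine M l) : M.Dep l := h.prop.1

theorem IsLine.subset_ground (h : IsLine M l) : l ⊆ M.E := h.dep.subset_ground

theorem IsLine.nonempty (h : IsLine M l) : l.Nonempty := h.dep.nonempty

theorem exists_isLine_superset [Finite α] (hs : M.Dep s)
    (h3 : ∀ t ⊆ s, t.encard = 3 → M.Dep t) : ∃ l, IsLine M l ∧ s ⊆ l := by
  obtain ⟨l, hsl, hl⟩ := Finite.exists_le_maximal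
    (p := fun s => M.Dep s ∧ ∀ t ⊆ s, t.encard = 3 → M.Dep t) ⟨hs, h3⟩
  exact ⟨l, hl, hsl⟩

theorem exists_isLine_of_dep [Finite α] (hs : M.Dep s) (h : s.encard = 3) :
    ∃ l, IsLine M l ∧ s ⊆ l := by
  refine exists_isLine_superset hs fun t hts ht => ?_
  have e : t = s := (Set.toFinite t).eq_of_subset_of_encard_le hts (by rw [h, ht])
  rwa [e]

theorem IsSimple.three_le_encard (hM : IsSimple M) (hs : M.Dep s) : 3 ≤ s.encard := by
  obtain ⟨C, hCs, hC⟩ := hs.exists_isCircuit_subset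
  refine le_trans ?_ (Set.encard_le_encard hCs)
  by_contra! hlt
  have h2 : C.encard ≤ 2 := Order.le_of_lt_add_one hlt
  rcases h2.lt_or_eq with h1 | h2
  · have h1 : C.encard ≤ 1 := Order.le_of_lt_add_one h1
    rcases Set.encard_le_one_iff_eq.mp h1 with h0 | ⟨x, rfl⟩
    · exact hC.nonempty.ne_empty h0
    · exact hM.1 x hC
  · obtain ⟨x, y, -, rfl⟩ := Set.encard_eq_two.mp h2
    exact hM.2 x y hC

theorem isLine_not_subset_singleton (hM : IsSimple M) (hl : IsLine M l) (P : α) : ¬ l ⊆ {P} := by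
  intro h
  have := (hM.three_le_encard hl.dep).trans (Set.encard_le_encard h)
  rw [Set.encard_singleton] at this
  exact absurd this (by decide)

/-- In a simple matroid of rank at most three the dependent sets are determined by the lines. -/
theorem dep_iff_of_isSimple [Finite α] (hM : IsSimple M) (hr : M.eRank ≤ 3) (hs : s ⊆ M.E) :
    M.Dep s ↔ 4 ≤ s.encard ∨ (s.encard = 3 ∧ ∃ l, IsLine M l ∧ s ⊆ l) := by
  constructor
  · intro h
    rcases (hM.three_le_encard h).eq_or_lt with h3 | h3
    · exact Or.inr ⟨h3.symm, exists_isLine_of_dep h h3.symm⟩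
    · exact Or.inl (Order.add_one_le_of_lt h3)
  · rintro (h | ⟨h3, l, hl, hsl⟩)
    · refine ⟨fun hi => ?_, hs⟩
      have := (h.trans hi.encard_le_eRank).trans hr
      exact absurd this (by decide)
    · exact hl.prop.2 s hsl h3

end Lines

/-! ### Connected cactus configurations are flexible -/

section Cactus

variable {α : Type*} {M : Matroid α}

theorem Flexible.union_leaves [Finite α] {E F : Set α} {L : Set (Set α)} (h : Flexible E L)
    (hF : ∀ q ∈ F, q ∉ E → (∃ l₀ ∈ L, q ∈ l₀ ∧ (∀ l ∈ L, q ∈ l → l = l₀) ∧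
      ∀ l ∈ L, l ≠ l₀ → ∃ x ∈ E, x ∈ l₀ ∧ x ∉ l) ∨ ∀ l ∈ L, q ∉ l) : Flexible (E ∪ F) L := by
  induction F, Set.toFinite F using Set.Finite.induction_on with
  | empty => simpa using h
  | @insert q F hq _ ih =>
    have ih := ih fun x hx => hF x (Set.mem_insert_of_mem _ hx)
    rw [Set.union_insert]
    by_cases hqE : q ∈ E ∪ F
    · rwa [Set.insert_eq_of_mem hqE]
    · rcases hF q (Set.mem_insert _ _) (fun h => hqE (Or.inl h)) with
        ⟨l₀, hl₀, hql, huniq, hsep⟩ | hfree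
      · refine ih.insert_leaf hqE hl₀ hql huniq fun l hl hne => ?_
        obtain ⟨x, hx, hx'⟩ := hsep l hl hne
        exact ⟨x, Or.inl hx, hx'⟩
      · exact ih.insert_free hqE hfree

theorem flexible_empty (L : Set (Set α)) : Flexible ∅ L := by
  intro c hc
  refine subset_closure ⟨hc, ?_, ?_, ?_⟩ <;> simp

theorem IsLineMatroid.isSimple (hM : IsLineMatroid M) : IsSimple M := by
  have key : ∀ s, s.encard ≤ 2 → ¬ M.IsCircuit s := fun s hs hC =>
    hC.dep.not_indep ((hM.2 s hC.subset_ground).mpr hs)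
  exact ⟨fun x => key _ (by rw [Set.encard_singleton]; decide),
    fun x y => key _ (Set.encard_insert_le {y} x |>.trans (by rw [Set.encard_singleton]; decide))⟩

/-- The only possible line is the whole ground set. All points are added to the empty configuration,
on that line if it exists and freely otherwise. -/
theorem IsLineMatroid.flexible [Finite α] (hM : IsLineMatroid M) :
    Flexible M.E {l | IsLine M l} := by
  have hdep : ∀ s ⊆ M.E, 2 < s.encard → M.Dep s := fun s hs h =>
    ⟨fun hi => absurd ((hM.2 s hs).mp hi) (not_le.mpr h), hs⟩
  have huniq : ∀ l, IsLine M l → l = M.E := by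
    intro l hl
    refine hl.subset_ground.antisymm (hl.2 (y := M.E) ⟨?_, fun t ht h3 => ?_⟩ hl.subset_ground)
    · exact hl.dep.superset hl.subset_ground
    · exact hdep t ht (by rw [h3]; decide)
  rw [← Set.empty_union M.E]
  refine (flexible_empty _).union_leaves fun q hq _ => ?_
  by_cases h : IsLine M M.E
  · exact Or.inl ⟨M.E, h, hq, fun l hl _ => huniq l hl, fun l hl hne => absurd (huniq l hl) hne⟩
  · exact Or.inr fun l hl _ => h (huniq l hl ▸ hl)

/-- The points `p i` form a polygon and every other point is a leaf on a side of it. -/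
theorem IsCycleMatroid.flexible [Finite α] (hM : IsCycleMatroid M) :
    Flexible M.E {l | IsLine M l} := by
  obtain ⟨-, -, -, n, hn, p, l, hp, hl, hr, hpl, hq⟩ := hM
  obtain ⟨N, rfl⟩ : ∃ N, n = N + 3 := ⟨n - 3, by omega⟩
  simp only [finRotate_apply] at hpl
  have hline : ∀ i, IsLine M (l i) := fun i => hr.subset ⟨i, rfl⟩
  have hpl' : ∀ i j, p i ∈ l j ↔ j = i ∨ j = i + 1 := by
    intro i j
    have : p i ∈ l j ↔ l j ∈ linesThrough M (p i) := ⟨fun h => ⟨hline j, h⟩, fun h => h.2⟩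
    rw [this, hpl, Set.mem_insert_iff, Set.mem_singleton_iff, hl.eq_iff, hl.eq_iff]
  have hpE : Set.range p ⊆ M.E := by
    rintro _ ⟨i, rfl⟩
    exact (hline i).subset_ground ((hpl' i i).mpr (Or.inl rfl))
  have e : Set.range p ∪ M.E = M.E := Set.union_eq_right.mpr hpE
  rw [← e, ← hr]
  refine (flexible_polygon hp hl hpl').union_leaves fun q hqE hqp => ?_
  obtain ⟨l₀, hl₀⟩ := Set.encard_eq_one.mp (hq q hqE hqp)
  have h₀ : IsLine M l₀ ∧ q ∈ l₀ := hl₀.symm.subset (Set.mem_singleton l₀)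
  refine Or.inl ⟨l₀, hr.symm.subset h₀.1, h₀.2, ?_, ?_⟩
  · rintro _ ⟨i, rfl⟩ hqi
    exact hl₀.subset ⟨hline i, hqi⟩
  · obtain ⟨i, rfl⟩ := hr.symm.subset h₀.1
    rintro _ ⟨j, rfl⟩ hne
    obtain ⟨k, rfl⟩ : ∃ k, i = k + 1 := ⟨i - 1, (sub_add_cancel _ _).symm⟩
    -- Having at least three sides, the polygon has no second side containing both corners `p k` and
    -- `p (k + 1)` of `l (k + 1)`; this provides the separating point.
    by_cases hj : p (k + 1) ∈ l j
    · refine ⟨p k, ⟨k, rfl⟩, (hpl' _ _).mpr (Or.inr rfl), fun hkj => ?_⟩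
      rcases (hpl' _ _).mp hj with rfl | rfl
      · exact hne rfl
      · rcases (hpl' _ _).mp hkj with h | h
        · exact fin_add_one_add_one_ne k h
        · exact fin_add_one_ne _ h
    · exact ⟨p (k + 1), ⟨k + 1, rfl⟩, (hpl' _ _).mpr (Or.inl rfl), hj⟩

theorem IsConnectedCactus.isSimple_and_flexible [Finite α] (hM : IsConnectedCactus M) :
    IsSimple M ∧ Flexible M.E {l | IsLine M l} := by
  induction hM with
  | line hM => exact ⟨hM.isSimple, hM.flexible⟩
  | cycle hM => exact ⟨hM.2.1, hM.flexible⟩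
  | @glue M N K P hM hN hK ih =>
    obtain ⟨hP, hE, hs, -, hL⟩ := hK
    have hN' : Flexible N.E {l | IsLine N l} := by
      rcases hN with hN | hN
      exacts [hN.flexible, hN.flexible]
    refine ⟨hs, ?_⟩
    have e : {l | IsLine K l} = {l | IsLine M l} ∪ {l | IsLine N l} := Set.ext hL
    rw [hE, e]
    refine ih.2.glue hN' hP ?_ (fun l hl => IsLine.subset_ground hl)
      fun l hl => IsLine.subset_ground hl
    -- A common line of both parts would be contained in `{P}`, but a line of a simple matroid has
    -- at least three points.
    refine Set.disjoint_left.mpr fun l h₁ h₂ => isLine_not_subset_singleton ih.1 h₁ P ?_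
    rw [← hP]
    exact Set.subset_inter (IsLine.subset_ground h₁) (IsLine.subset_ground h₂)

/-! ### Components -/

theorem mem_component_self {p : α} (hp : p ∈ M.E) : p ∈ component M p :=
  ⟨hp, Relation.ReflTransGen.refl⟩

theorem component_subset_ground (p : α) : component M p ⊆ M.E := fun _ h => h.1

theorem component_subset_of_mem {p q : α} (h : q ∈ component M p) :
    component M q ⊆ component M p := fun _ hx => ⟨hx.1, h.2.trans hx.2⟩

theorem mem_component_symm {p q : α} (hp : p ∈ M.E) (h : q ∈ component M p) :
    p ∈ component M q := by
  refine ⟨hp, ?_⟩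
  have hsymm : Std.Symm fun a b => ∃ l, IsLine M l ∧ a ∈ l ∧ b ∈ l :=
    ⟨fun a b ⟨l, h1, h2, h3⟩ => ⟨l, h1, h3, h2⟩⟩
  exact Std.Symm.symm (r := Relation.ReflTransGen _) _ _ h.2

theorem IsLine.subset_component {l : Set α} (hl : IsLine M l) {p q : α} (hq : q ∈ l)
    (hqp : q ∈ component M p) : l ⊆ component M p := fun _ hx =>
  ⟨hl.subset_ground hx, hqp.2.tail ⟨l, hl, hq, hx⟩⟩

theorem isLine_restrict_component [Finite α] {p : α} {l : Set α} :
    IsLine (M.restrict (component M p)) l ↔ IsLine M l ∧ l ⊆ component M p := by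
  have hdep : ∀ s, (M.restrict (component M p)).Dep s ↔ M.Dep s ∧ s ⊆ component M p := by
    intro s
    rw [Matroid.restrict_dep_iff]
    exact ⟨fun h => ⟨⟨h.1, h.2.trans (component_subset_ground p)⟩, h.2⟩,
      fun h => ⟨h.1.not_indep, h.2⟩⟩
  constructor
  · intro h
    have hlC := ((hdep l).mp h.dep).2
    obtain ⟨l', hl', hll'⟩ := exists_isLine_superset ((hdep l).mp h.dep).1
      fun t ht h3 => ((hdep t).mp (h.prop.2 t ht h3)).1
    obtain ⟨x, hx⟩ := h.nonempty
    have hl'C : l' ⊆ component M p := hl'.subset_component (hll' hx) (hlC hx)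
    have : l' ⊆ l := h.2 ⟨(hdep l').mpr ⟨hl'.dep, hl'C⟩, fun t ht h3 =>
      (hdep t).mpr ⟨hl'.prop.2 t ht h3, ht.trans hl'C⟩⟩ hll'
    rw [hll'.antisymm this]
    exact ⟨hl', hl'C⟩
  · rintro ⟨h, hC⟩
    refine ⟨⟨(hdep l).mpr ⟨h.dep, hC⟩, fun t ht h3 =>
      (hdep t).mpr ⟨h.prop.2 t ht h3, ht.trans hC⟩⟩, ?_⟩
    rintro s ⟨hs, hs3⟩ hls
    exact h.2 ⟨((hdep s).mp hs).1, fun t ht h3 => ((hdep t).mp (hs3 t ht h3)).1⟩ hls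

theorem IsCactus.flexible [Finite α] (hM : IsCactus M) : Flexible M.E {l | IsLine M l} := by
  have key : ∀ S : Set α, S ⊆ M.E → Flexible (⋃ p ∈ S, component M p)
      {l | IsLine M l ∧ l ⊆ ⋃ p ∈ S, component M p} := by
    intro S
    induction S, Set.toFinite S using Set.Finite.induction_on with
    | empty => intro _; simpa using flexible_empty _
    | @insert p S hp _ ih =>
      intro hS
      have ih := ih ((Set.subset_insert _ _).trans hS)
      have hpE : p ∈ M.E := hS (Set.mem_insert _ _)
      rw [Set.biUnion_insert]
      by_cases hpS : p ∈ ⋃ p ∈ S, component M p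
      · have : component M p ⊆ ⋃ p ∈ S, component M p := by
          obtain ⟨q, hq, hpq⟩ := Set.mem_iUnion₂.mp hpS
          exact (component_subset_of_mem hpq).trans (Set.subset_biUnion_of_mem hq)
        rwa [Set.union_eq_right.mpr this]
      · have hdis : Disjoint (component M p) (⋃ p ∈ S, component M p) := by
          refine Set.disjoint_left.mpr fun x hx hxS => hpS ?_
          obtain ⟨q, hq, hxq⟩ := Set.mem_iUnion₂.mp hxS
          exact Set.mem_biUnion hq (component_subset_of_mem hxq (mem_component_symm hpE hx))
        have hfp := (hM.2.2 p hpE).isSimple_and_flexible.2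
        simp only [isLine_restrict_component, Matroid.restrict_ground_eq] at hfp
        have e : {l | IsLine M l ∧ l ⊆ component M p ∪ ⋃ p ∈ S, component M p} =
            {l | IsLine M l ∧ l ⊆ component M p} ∪
              {l | IsLine M l ∧ l ⊆ ⋃ p ∈ S, component M p} := by
          ext l
          constructor
          · rintro ⟨hl, hlS⟩
            obtain ⟨x, hx⟩ := hl.nonempty
            rcases hlS hx with hxp | hxS
            · exact Or.inl ⟨hl, hl.subset_component hx hxp⟩
            · obtain ⟨q, hq, hxq⟩ := Set.mem_iUnion₂.mp hxS
              exact Or.inr ⟨hl, (hl.subset_component hx hxq).trans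
                (Set.subset_biUnion_of_mem hq)⟩
          · rintro (⟨hl, h⟩ | ⟨hl, h⟩)
            exacts [⟨hl, h.trans Set.subset_union_left⟩, ⟨hl, h.trans Set.subset_union_right⟩]
        rw [e]
        refine hfp.disjoint_union ih (mem_component_self hpE) hdis ?_ (fun l hl => hl.2)
          fun l hl => hl.2
        refine Set.disjoint_left.mpr fun l h₁ h₂ => ?_
        obtain ⟨x, hx⟩ := h₁.1.nonempty
        exact Set.disjoint_left.mp hdis (h₁.2 hx) (h₂.2 hx)
  have h := key M.E le_rfl
  have e : ⋃ p ∈ M.E, component M p = M.E :=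
    (Set.iUnion₂_subset fun p _ => component_subset_ground p).antisymm
      fun p hp => Set.mem_biUnion hp (mem_component_self hp)
  rw [e] at h
  have e' : {l | IsLine M l ∧ l ⊆ M.E} = {l | IsLine M l} :=
    Set.ext fun l => ⟨fun h => h.1, fun h => ⟨h, h.subset_ground⟩⟩
  rwa [e'] at h

end Cactus
/-! ### Acyclic sets of points -/

section Acyclic

variable {α : Type*} {M : Matroid α}

theorem injective_of_no_repetition {β : Type*} {f : ℕ → β} {k : ℕ}
    (h : ∀ m, 1 ≤ m → m < k → ∀ i, f i ≠ f (i + m)) (i : ℕ) :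
    Function.Injective fun j : Fin k => f (i + j) := by
  intro a b hab
  by_contra hne
  have key : ∀ a b : Fin k, a < b → f (i + a) ≠ f (i + b) := by
    intro a b hlt
    have hlt' : a.val < b.val := hlt
    have := h (b.val - a.val) (by omega) (by omega) (i + a.val)
    rwa [show i + a.val + (b.val - a.val) = i + b.val by omega] at this
  rcases lt_or_gt_of_ne hne with hlt | hlt
  · exact key a b hlt hab
  · exact key b a hlt hab.symm

/-- A nonbacktracking walk in a finite point-line geometry contains a cycle. -/
theorem containsCycle_of_walk [Finite α] {X : Set α} {x : ℕ → α} {l : ℕ → Set α}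
    (hx : ∀ n, x n ∈ X) (hl : ∀ n, IsLine M (l n)) (h₁ : ∀ n, x n ∈ l n)
    (h₂ : ∀ n, x (n + 1) ∈ l n) (hxx : ∀ n, x n ≠ x (n + 1)) (hll : ∀ n, l n ≠ l (n + 1)) :
    ContainsCycle M X := by
  classical
  -- The cycle is cut out at the smallest distance `k` at which a point or a line repeats.
  -- Minimality makes any `k` consecutive points, and any `k` consecutive lines, distinct.
  have hex : ∃ k, 1 ≤ k ∧ ∃ i, x i = x (i + k) ∨ l i = l (i + k) := by
    obtain ⟨i, j, hij, he⟩ := Finite.exists_ne_map_eq_of_infinite x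
    rcases lt_or_gt_of_ne hij with h | h
    · exact ⟨j - i, by omega, i, Or.inl (by rw [he]; congr 1; omega)⟩
    · exact ⟨i - j, by omega, j, Or.inl (by rw [← he]; congr 1; omega)⟩
  obtain ⟨hk1, i, hi⟩ := Nat.find_spec hex
  have hmin : ∀ m, 1 ≤ m → m < Nat.find hex → ∀ i, x i ≠ x (i + m) ∧ l i ≠ l (i + m) := by
    intro m hm hmk i
    have := Nat.find_min hex hmk
    push Not at this
    exact this hm i
  generalize Nat.find hex = k at hk1 hi hmin
  obtain ⟨n, rfl⟩ : ∃ n, k = n + 1 := ⟨k - 1, by omega⟩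
  have hk2 : 2 ≤ n + 1 := by
    by_contra hlt
    obtain rfl : n = 0 := by omega
    rcases hi with h | h
    exacts [hxx i h, hll i h]
  have key : ∀ i, x i ∈ l (i + n) → ContainsCycle M X := by
    intro i hi
    refine ⟨n + 1, hk2, fun j => x (i + j), fun j => l (i + j),
      injective_of_no_repetition (fun m h h' i => (hmin m h h' i).1) i,
      injective_of_no_repetition (fun m h h' i => (hmin m h h' i).2) i,
      fun j => hx _, fun j => ⟨hl _, h₁ _, ?_⟩⟩
    simp only [coe_finRotate]
    split_ifs with hj
    · subst hj; simpa using hi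
    · exact h₂ (i + j)
  -- A repeated point closes the walk at once; for a repeated line the cycle starts one point later.
  rcases hi with h | h
  · refine key i ?_
    rw [h]
    exact h₂ (i + n)
  · refine key (i + 1) ?_
    rw [show i + 1 + n = i + (n + 1) by ring, ← h]
    exact h₂ i

/-- Otherwise each point of `S` can be left towards another point of `S` along a line different from
the line of arrival, giving an infinite nonbacktracking walk. Its states are pairs of a point and
the line of arrival, with `∅` as a dummy first line. -/
theorem exists_leaf_of_acyclic [Finite α] {X S : Set α} (hX : ¬ ContainsCycle M X) (hS : S ⊆ X)
    (hne : S.Nonempty) : ∃ x ∈ S, ∀ l₁ l₂, IsLine M l₁ → IsLine M l₂ → x ∈ l₁ → x ∈ l₂ →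
      (∃ y ∈ S, y ≠ x ∧ y ∈ l₁) → (∃ y ∈ S, y ≠ x ∧ y ∈ l₂) → l₁ = l₂ := by
  by_contra! hcon
  have next : ∀ s : {s : α × Set α // s.1 ∈ S}, ∃ t : {s : α × Set α // s.1 ∈ S},
      IsLine M t.1.2 ∧ s.1.1 ∈ t.1.2 ∧ t.1.1 ∈ t.1.2 ∧ s.1.1 ≠ t.1.1 ∧ s.1.2 ≠ t.1.2 := by
    rintro ⟨⟨x, l⟩, hx⟩
    obtain ⟨l₁, l₂, h₁, h₂, hx₁, hx₂, ⟨y₁, hy₁, hn₁, hyl₁⟩, ⟨y₂, hy₂, hn₂, hyl₂⟩, hne⟩ := hcon x hx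
    by_cases h : l = l₁
    · exact ⟨⟨(y₂, l₂), hy₂⟩, h₂, hx₂, hyl₂, hn₂.symm, by simpa [h] using hne⟩
    · exact ⟨⟨(y₁, l₁), hy₁⟩, h₁, hx₁, hyl₁, hn₁.symm, h⟩
  choose f hf using next
  obtain ⟨x₀, hx₀⟩ := hne
  let s : ℕ → {s : α × Set α // s.1 ∈ S} := fun n => f^[n] ⟨(x₀, ∅), hx₀⟩
  have hs : ∀ n, s (n + 1) = f (s n) := fun n => Function.iterate_succ_apply' _ _ _
  refine hX (containsCycle_of_walk (x := fun n => (s n).1.1) (l := fun n => (s (n + 1)).1.2)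
    (fun n => hS (s n).2) ?_ ?_ ?_ ?_ ?_) <;> intro n <;> rw [hs]
  · exact (hf _).1
  · exact (hf _).2.1
  · exact (hf _).2.2.1
  · exact (hf _).2.2.2.1
  · rw [hs (n + 1), ← hs n]; exact (hf _).2.2.2.2

end Acyclic

/-! ### Completing degenerate configurations -/

section Completion

variable {α : Type*} {M : Matroid α} {γ : α → Vec3}

/-- The intersection point of the lines `ab` and `cd` in the projective plane. -/
def meetVec (a b c d : Vec3) : Vec3 := tri a b c • d - tri a b d • c

theorem dot_meetVec_left (h a b c d : Vec3) (ha : h ⬝ᵥ a = 0) (hb : h ⬝ᵥ b = 0) :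
    h ⬝ᵥ meetVec a b c d = 0 := by
  have : h ⬝ᵥ meetVec a b c d = (h ⬝ᵥ a) * tri b c d - (h ⬝ᵥ b) * tri a c d := by
    simp only [meetVec, dot_expand, tri_expand, Pi.sub_apply, Pi.smul_apply, smul_eq_mul]; ring
  rw [this, ha, hb]; ring

theorem dot_meetVec_right (h a b c d : Vec3) (hc : h ⬝ᵥ c = 0) (hd : h ⬝ᵥ d = 0) :
    h ⬝ᵥ meetVec a b c d = 0 := by
  rw [meetVec, dotProduct_sub, dotProduct_smul, dotProduct_smul, hc, hd, smul_zero, smul_zero,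
    sub_zero]

theorem tri_eq_zero_of_meetVec {a b c d : Vec3} (hcd : c ⨯₃ d ≠ 0) (h : meetVec a b c d = 0) :
    tri a b c = 0 ∧ tri a b d = 0 := by
  rw [meetVec] at h
  constructor
  · have : c ⨯₃ (tri a b c • d - tri a b d • c) = 0 := by rw [h, map_zero]
    rw [map_sub, map_smul, map_smul, cross_self, smul_zero, sub_zero] at this
    exact (smul_eq_zero.mp this).resolve_right hcd
  · have : (tri a b c • d - tri a b d • c) ⨯₃ d = 0 := by rw [h, map_zero, LinearMap.zero_apply]
    rw [map_sub, map_smul, map_smul, LinearMap.sub_apply, LinearMap.smul_apply,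
      LinearMap.smul_apply, cross_self, smul_zero, zero_sub, neg_eq_zero] at this
    exact (smul_eq_zero.mp this).resolve_right hcd

/-- Every set of pairwise parallel vectors lies in a plane through any given vector. -/
theorem exists_plane_of_parallel {l : Set α} (hl : ∀ a ∈ l, ∀ b ∈ l, γ a ⨯₃ γ b = 0) (v : Vec3) :
    ∃ h : Vec3, h ≠ 0 ∧ h ⬝ᵥ v = 0 ∧ ∀ x ∈ l, h ⬝ᵥ γ x = 0 := by
  by_cases h0 : ∃ a ∈ l, γ a ≠ 0
  · obtain ⟨a, ha, ha0⟩ := h0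
    obtain ⟨h, hh, h1, h2⟩ := exists_common_orth v (γ a)
    refine ⟨h, hh, by rwa [dotProduct_comm], fun x hx => ?_⟩
    obtain ⟨k, hk⟩ := exists_smul_of_cross_eq_zero ha0 (hl a ha x hx)
    rw [hk, dotProduct_smul, dotProduct_comm, h2, smul_zero]
  · push Not at h0
    obtain ⟨h, hh, h1, -⟩ := exists_common_orth v 0
    exact ⟨h, hh, by rwa [dotProduct_comm], fun x hx => by rw [h0 x hx, dotProduct_zero]⟩

theorem exists_plane_of_tri {l : Set α}
    (hl : ∀ a ∈ l, ∀ b ∈ l, ∀ c ∈ l, tri (γ a) (γ b) (γ c) = 0) :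
    ∃ h : Vec3, h ≠ 0 ∧ ∀ x ∈ l, h ⬝ᵥ γ x = 0 := by
  by_cases h0 : ∀ a ∈ l, ∀ b ∈ l, γ a ⨯₃ γ b = 0
  · obtain ⟨h, hh, -, h1⟩ := exists_plane_of_parallel h0 0
    exact ⟨h, hh, h1⟩
  · push Not at h0
    obtain ⟨a, ha, b, hb, hab⟩ := h0
    refine ⟨_, hab, fun x hx => ?_⟩
    rw [dotProduct_comm]
    exact hl x hx a ha b hb

variable (M) in
/-- The vectors `γ` span at most a plane on each line, and no zero vector is determined by two
lines through it. -/
def IsSaturated (γ : α → Vec3) : Prop :=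
  (∀ l, IsLine M l → ∀ a ∈ l, ∀ b ∈ l, ∀ c ∈ l, tri (γ a) (γ b) (γ c) = 0) ∧
  ∀ x, γ x = 0 → ∀ l₁ l₂, IsLine M l₁ → IsLine M l₂ → l₁ ≠ l₂ → x ∈ l₁ → x ∈ l₂ →
    ∀ a ∈ l₁, ∀ b ∈ l₁, ∀ c ∈ l₂, ∀ d ∈ l₂, meetVec (γ a) (γ b) (γ c) (γ d) = 0

/-- If the vectors on each of two lines through a zero column span a plane, the vanishing of their
meets makes the planes equal. -/
theorem IsSaturated.plane_orth (hγ : IsSaturated M γ) {x : α} (hx : γ x = 0) {l₁ l₂ : Set α}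
    (h₁ : IsLine M l₁) (h₂ : IsLine M l₂) (hx₁ : x ∈ l₁) (hx₂ : x ∈ l₂) {a b c d : α}
    (ha : a ∈ l₁) (hb : b ∈ l₁) (hc : c ∈ l₂) (hd : d ∈ l₂) (hab : γ a ⨯₃ γ b ≠ 0)
    (hcd : γ c ⨯₃ γ d ≠ 0) {H₁ H₂ v : Vec3} (hH₁0 : H₁ ≠ 0) (hH₁ : ∀ y ∈ l₁, H₁ ⬝ᵥ γ y = 0)
    (hH₂ : ∀ y ∈ l₂, H₂ ⬝ᵥ γ y = 0) (hv : H₁ ⬝ᵥ v = 0) : H₂ ⬝ᵥ v = 0 := by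
  have hcd₁ : H₁ ⬝ᵥ γ c = 0 ∧ H₁ ⬝ᵥ γ d = 0 := by
    by_cases he : l₁ = l₂
    · subst he
      exact ⟨hH₁ c hc, hH₁ d hd⟩
    · obtain ⟨t1, t2⟩ := tri_eq_zero_of_meetVec hcd
        (hγ.2 x hx l₁ l₂ h₁ h₂ he hx₁ hx₂ a ha b hb c hc d hd)
      obtain ⟨k, hk⟩ := exists_smul_cross_of_orth hab
        (by rw [dotProduct_comm]; exact hH₁ a ha) (by rw [dotProduct_comm]; exact hH₁ b hb)
      rw [tri_rotate, tri_rotate, tri, dotProduct_comm] at t1 t2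
      rw [hk, smul_dotProduct, smul_dotProduct, t1, t2, smul_zero]
      exact ⟨rfl, rfl⟩
  obtain ⟨k, hk⟩ := exists_smul_cross_of_orth hcd
    (by rw [dotProduct_comm]; exact hcd₁.1) (by rw [dotProduct_comm]; exact hcd₁.2)
  obtain ⟨m, hm⟩ := exists_smul_cross_of_orth hcd
    (by rw [dotProduct_comm]; exact hH₂ c hc) (by rw [dotProduct_comm]; exact hH₂ d hd)
  have hk0 : k ≠ 0 := by rintro rfl; simp at hk; exact hH₁0 hk
  rw [hk, smul_dotProduct, smul_eq_mul] at hv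
  rw [hm, smul_dotProduct, (mul_eq_zero.mp hv).resolve_left hk0, smul_zero]

/-- Planes for all lines that are concurrent at the points of an acyclic set of zero vectors. -/
theorem IsSaturated.exists_planes [Finite α] (hγ : IsSaturated M γ) {X : Set α}
    (hX : ¬ ContainsCycle M X) (n : ℕ) : ∀ S ⊆ X, (∀ x ∈ S, γ x = 0) → S.ncard = n →
    ∃ h : Set α → Vec3, (∀ l, IsLine M l → h l ≠ 0 ∧ ∀ x ∈ l, h l ⬝ᵥ γ x = 0) ∧
      ∀ x ∈ S, ∃ v : Vec3, v ≠ 0 ∧ ∀ l, IsLine M l → x ∈ l → h l ⬝ᵥ v = 0 := by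
  classical
  induction n with
  | zero =>
    intro S _ _ hS
    obtain rfl : S = ∅ := (Set.ncard_eq_zero).mp hS
    have : ∀ l : Set α, ∃ h : Vec3, IsLine M l → h ≠ 0 ∧ ∀ x ∈ l, h ⬝ᵥ γ x = 0 := by
      intro l
      by_cases hl : IsLine M l
      · obtain ⟨h, hh⟩ := exists_plane_of_tri (hγ.1 l hl)
        exact ⟨h, fun _ => hh⟩
      · exact ⟨0, fun h => absurd h hl⟩
    choose h hh using this
    exact ⟨h, hh, by simp⟩
  | succ n ih =>
    intro S hSX hS0 hS
    obtain ⟨x, hxS, hleaf⟩ := exists_leaf_of_acyclic hX hSX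
      (Set.nonempty_of_ncard_ne_zero (by omega))
    obtain ⟨h, hh, hv⟩ := ih (S \ {x}) (Set.sdiff_subset.trans hSX) (fun y hy => hS0 y hy.1)
      (by rw [Set.ncard_sdiff_singleton_of_mem hxS, hS, Nat.add_sub_cancel])
    -- As `x` is a leaf, at most one line through it carries other points of `S`. Its plane `H₀`
    -- must be kept; the value `0` imposes no condition.
    obtain ⟨H₀, hH₀⟩ : ∃ H₀ : Vec3, ∀ l, IsLine M l → x ∈ l → (∃ y ∈ S, y ≠ x ∧ y ∈ l) →
        h l = H₀ := by
      by_cases he : ∃ l, IsLine M l ∧ x ∈ l ∧ ∃ y ∈ S, y ≠ x ∧ y ∈ l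
      · obtain ⟨l₀, h1, h2, h3⟩ := he
        exact ⟨h l₀, fun l hl hxl hy => by rw [hleaf l l₀ hl h1 hxl h2 hy h3]⟩
      · exact ⟨0, fun l hl hxl hy => absurd ⟨l, hl, hxl, hy⟩ he⟩
    -- The lines through `x` whose vectors span a plane all have one and the same plane `H₁`.
    obtain ⟨H₁, hH₁⟩ : ∃ H₁ : Vec3, ∀ v, H₁ ⬝ᵥ v = 0 → ∀ l, IsLine M l → x ∈ l →
        (∃ a ∈ l, ∃ b ∈ l, γ a ⨯₃ γ b ≠ 0) → h l ⬝ᵥ v = 0 := by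
      by_cases he : ∃ l, IsLine M l ∧ x ∈ l ∧ ∃ a ∈ l, ∃ b ∈ l, γ a ⨯₃ γ b ≠ 0
      · obtain ⟨l₁, h1, h2, a, ha, b, hb, hab⟩ := he
        refine ⟨h l₁, fun v hv l hl hxl ⟨c, hc, d, hd, hcd⟩ => ?_⟩
        exact hγ.plane_orth (hS0 x hxS) h1 hl h2 hxl ha hb hc hd hab hcd (hh l₁ h1).1
          (hh l₁ h1).2 (hh l hl).2 hv
      · exact ⟨0, fun v _ l hl hxl hab => absurd ⟨l, hl, hxl, hab⟩ he⟩
    obtain ⟨v, hv0, hvH₀, hvH₁⟩ := exists_common_orth H₀ H₁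
    have hnew : ∀ l : Set α, ∃ H : Vec3, (∀ a ∈ l, ∀ b ∈ l, γ a ⨯₃ γ b = 0) →
        H ≠ 0 ∧ H ⬝ᵥ v = 0 ∧ ∀ y ∈ l, H ⬝ᵥ γ y = 0 := by
      intro l
      by_cases hl : ∀ a ∈ l, ∀ b ∈ l, γ a ⨯₃ γ b = 0
      · obtain ⟨H, hH⟩ := exists_plane_of_parallel hl v
        exact ⟨H, fun _ => hH⟩
      · exact ⟨0, fun h => absurd h hl⟩
    choose H hH using hnew
    -- The planes of these lines are chosen anew through `v`. They contain no other point of `S`, so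
    -- concurrency there is undisturbed; all other lines through `x` have plane `H₀` or `H₁`, which
    -- already contain `v`.
    let free : Set α → Prop := fun l => x ∈ l ∧ (∀ a ∈ l, ∀ b ∈ l, γ a ⨯₃ γ b = 0) ∧
      ¬ ∃ y ∈ S, y ≠ x ∧ y ∈ l
    refine ⟨fun l => if free l then H l else h l, fun l hl => ?_, fun y hy => ?_⟩
    · by_cases hf : free l
      · simp only [if_pos hf]
        exact ⟨(hH l hf.2.1).1, (hH l hf.2.1).2.2⟩
      · simp only [if_neg hf]
        exact hh l hl
    · by_cases hyx : y = x
      · subst hyx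
        refine ⟨v, hv0, fun l hl hyl => ?_⟩
        by_cases hf : free l
        · simp only [if_pos hf]
          exact (hH l hf.2.1).2.1
        · simp only [if_neg hf]
          by_cases h2 : ∃ a ∈ l, ∃ b ∈ l, γ a ⨯₃ γ b ≠ 0
          · exact hH₁ v hvH₁ l hl hyl h2
          · by_cases hz : ∃ z ∈ S, z ≠ y ∧ z ∈ l
            · rwa [hH₀ l hl hyl hz]
            · push Not at h2
              exact absurd ⟨hyl, h2, hz⟩ hf
      · obtain ⟨v', hv', hvl⟩ := hv y ⟨hy, hyx⟩
        refine ⟨v', hv', fun l hl hyl => ?_⟩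
        have hf : ¬ free l := fun hf => hf.2.2 ⟨y, hy, hyx, hyl⟩
        simp only [if_neg hf]
        exact hvl l hl hyl

theorem exists_subset_pair_of_encard_lt {β : Type*} [Nonempty β] {s : Set β}
    (hs : s.encard < 3) : ∃ a b, s ⊆ {a, b} := by
  have h2 : s.encard ≤ 2 := Order.le_of_lt_add_one hs
  rcases h2.lt_or_eq with h1 | h2
  · rcases Set.encard_le_one_iff_eq.mp (Order.le_of_lt_add_one h1 : s.encard ≤ 1) with rfl | ⟨x, rfl⟩
    · obtain ⟨b⟩ := ‹Nonempty β›
      exact ⟨b, b, Set.empty_subset _⟩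
    · exact ⟨x, x, by simp⟩
  · obtain ⟨x, y, -, rfl⟩ := Set.encard_eq_two.mp h2
    exact ⟨x, y, le_rfl⟩

/-- A saturated family of vectors is a rescaling of a family of nonzero vectors that respects the
incidences. -/
theorem IsSaturated.exists_inc [Finite α] (hγ : IsSaturated M γ)
    (hQ : ¬ ContainsCycle M (pointsOfDegreeGeThree M)) :
    ∃ c ∈ Inc Set.univ {l | IsLine M l}, ∀ x, ∃ m : ℂ, γ x = m • c.1 x := by
  obtain ⟨h, hh, hv⟩ := hγ.exists_planes hQ _ {x | x ∈ pointsOfDegreeGeThree M ∧ γ x = 0}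
    (fun x hx => hx.1) (fun x hx => hx.2) rfl
  have : ∀ x, ∃ v : Vec3, v ≠ 0 ∧ (∀ l, IsLine M l → x ∈ l → h l ⬝ᵥ v = 0) ∧
      ∃ m : ℂ, γ x = m • v := by
    intro x
    by_cases hx : γ x = 0
    · suffices ∃ v : Vec3, v ≠ 0 ∧ ∀ l, IsLine M l → x ∈ l → h l ⬝ᵥ v = 0 by
        obtain ⟨v, hv, hvl⟩ := this
        exact ⟨v, hv, hvl, 0, by rw [hx, zero_smul]⟩
      by_cases hxQ : x ∈ pointsOfDegreeGeThree M
      · exact hv x ⟨hxQ, hx⟩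
      · by_cases hxE : x ∈ M.E
        -- Two planes always share a nonzero vector, so points of degree at most two need no
        -- preparation.
        · have hlt : (linesThrough M x).encard < 3 := not_le.mp fun h3 => hxQ ⟨hxE, h3⟩
          obtain ⟨a, b, hab⟩ := exists_subset_pair_of_encard_lt hlt
          obtain ⟨v, hv, h1, h2⟩ := exists_common_orth (h a) (h b)
          refine ⟨v, hv, fun l hl hxl => ?_⟩
          rcases hab ⟨hl, hxl⟩ with rfl | rfl
          exacts [h1, h2]
        · obtain ⟨v, hv, -, -⟩ := exists_common_orth 0 0
          exact ⟨v, hv, fun l hl hxl => absurd (hl.subset_ground hxl) hxE⟩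
    · exact ⟨γ x, hx, fun l hl hxl => (hh l hl).2 x hxl, 1, (one_smul _ _).symm⟩
  choose v hv0 hvl hvm using this
  exact ⟨(v, h), ⟨fun x _ => hv0 x, fun l hl => (hh l hl).1, fun l hl x _ hxl => hvl x l hl hxl⟩,
    hvm⟩

end Completion
open MvPolynomial

/-! ### Evaluating the generators -/

section Evaluation

variable {d : ℕ} {M : Matroid (Fin d)}

/-- The columns of a `3 × d` matrix. -/
def column (γ : Fin 3 × Fin d → ℂ) (j : Fin d) : Vec3 := fun i => γ (i, j)

theorem aeval_bracket (γ : Fin 3 × Fin d → ℂ) (a b c : Fin d) :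
    aeval γ (bracket a b c) = tri (column γ a) (column γ b) (column γ c) := by
  simp only [bracket, genericMatrix, Matrix.det_fin_three, tri_expand, column,
    Matrix.submatrix_apply, Matrix.of_apply, id, map_add, map_sub, map_mul, aeval_X]
  simp only [Matrix.cons_val]
  ring

theorem aeval_meet (γ : Fin 3 × Fin d → ℂ) (a b c e : Fin d) (i : Fin 3) :
    aeval γ (meet a b c e i) =
      meetVec (column γ a) (column γ b) (column γ c) (column γ e) i := by
  simp only [meet, map_sub, map_mul, aeval_bracket, genericMatrix, Matrix.of_apply, aeval_X]
  rfl

theorem linearIndepOn_triple_iff {v : Fin d → Vec3} {a b c : Fin d} (hab : a ≠ b) (hac : a ≠ c)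
    (hbc : b ≠ c) : LinearIndepOn ℂ v {a, b, c} ↔ tri (v a) (v b) (v c) ≠ 0 := by
  have hinj : Function.Injective ![a, b, c] := by
    intro i j
    fin_cases i <;> fin_cases j <;> simp [hab, hac, hbc, hab.symm, hac.symm, hbc.symm]
  have hr : ({a, b, c} : Set (Fin d)) = Set.range ![a, b, c] := by
    ext x
    simp only [Matrix.range_cons, Matrix.range_empty, Set.union_empty, Set.mem_insert_iff,
      Set.mem_union, Set.mem_singleton_iff]
  rw [hr, linearIndepOn_range_iff hinj, ← linearIndependent_iff_tri]
  have : v ∘ ![a, b, c] = ![v a, v b, v c] := by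
    funext i; fin_cases i <;> rfl
  rw [this]

theorem tri_eq_zero_of_not_distinct {v : Fin d → Vec3} {a b c : Fin d}
    (h : ¬ (a ≠ b ∧ a ≠ c ∧ b ≠ c)) : tri (v a) (v b) (v c) = 0 := by
  by_cases hab : a = b
  · subst hab; simp only [tri_expand]; ring
  by_cases hac : a = c
  · subst hac; simp only [tri_expand]; ring
  by_cases hbc : b = c
  · subst hbc; simp only [tri_expand]; ring
  exact absurd ⟨hab, hac, hbc⟩ h

/-! ### Generic configurations are realizations -/

theorem dep_of_subset_line {l : Set (Fin d)} (hl : IsLine M l) {a b c : Fin d} (hab : a ≠ b)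
    (hac : a ≠ c) (hbc : b ≠ c) (ha : a ∈ l) (hb : b ∈ l) (hc : c ∈ l) : M.Dep {a, b, c} := by
  refine hl.prop.2 _ ?_ (Set.encard_eq_three.mpr ⟨a, b, c, hab, hac, hbc, rfl⟩)
  rintro x (rfl | rfl | rfl) <;> assumption

theorem mem_realizationSpace_of_gen (hE : M.E = Set.univ) (hM : IsSimple M) (hr : M.eRank ≤ 3)
    {c : Config (Fin d)} (hc : c ∈ Gen Set.univ {l | IsLine M l}) {γ : Fin 3 × Fin d → ℂ}
    (hγ : ∀ j, column γ j = c.1 j) : γ ∈ realizationSpace M := by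
  intro s
  have hcol : (fun (j : Fin d) (i : Fin 3) => γ (i, j)) = c.1 := funext hγ
  rw [hcol, dep_iff_of_isSimple hM hr (by rw [hE]; exact Set.subset_univ s)]
  have hnl : ∀ {a b e : Fin d}, a ≠ b → a ≠ e → b ≠ e →
      (tri (c.1 a) (c.1 b) (c.1 e) = 0 ↔ ∃ l, IsLine M l ∧ a ∈ l ∧ b ∈ l ∧ e ∈ l) := by
    intro a b e hab hae hbe
    constructor
    · intro ht
      by_contra hn
      exact hc.2.2.1 a trivial b trivial e trivial hab hae hbe hn ht
    · rintro ⟨l, hl, ha, hb, he⟩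
      exact tri_eq_zero_of_orth (hc.1.2.1 l hl) (hc.1.2.2 l hl a trivial ha)
        (hc.1.2.2 l hl b trivial hb) (hc.1.2.2 l hl e trivial he)
  constructor
  · rintro (h4 | ⟨h3, l, hl, hsl⟩) hli
    · have := h4.trans hli.encard_le_toENat_rank
      simp only [rank_fun', Fintype.card_fin] at this
      exact absurd this (by simp; decide)
    · obtain ⟨a, b, e, hab, hae, hbe, rfl⟩ := Set.encard_eq_three.mp h3
      rw [linearIndepOn_triple_iff hab hae hbe] at hli
      exact hli ((hnl hab hae hbe).mpr ⟨l, hl, hsl (by simp), hsl (by simp), hsl (by simp)⟩)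
  · intro hli
    by_contra hn
    push Not at hn
    apply hli
    have h3 : s.encard ≤ 3 := Order.le_of_lt_add_one hn.1
    rcases h3.lt_or_eq with h2 | h3
    · have h2 : s.encard ≤ 2 := Order.le_of_lt_add_one h2
      rcases h2.lt_or_eq with h1 | h2
      · rcases Set.encard_le_one_iff_eq.mp (Order.le_of_lt_add_one h1 : s.encard ≤ 1) with
          rfl | ⟨x, rfl⟩
        · exact linearIndepOn_empty _ _
        · exact LinearIndepOn.singleton (hc.1.1 x trivial)
      · obtain ⟨x, y, hxy, rfl⟩ := Set.encard_eq_two.mp h2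
        rw [linearIndepOn_pair_iff _ hxy (hc.1.1 x trivial)]
        intro k hk
        refine hc.2.1 x trivial y trivial hxy ?_
        rw [← hk, cross_smul_self]
    · obtain ⟨a, b, e, hab, hae, hbe, rfl⟩ := Set.encard_eq_three.mp h3
      rw [linearIndepOn_triple_iff hab hae hbe, Ne, hnl hab hae hbe]
      rintro ⟨l, hl, ha, hb, he⟩
      refine hn.2 h3 l hl ?_
      rintro x (rfl | rfl | rfl) <;> assumption

/-! ### The generators vanish on the realization space -/

theorem column_ne_zero (hM : IsSimple M) {γ : Fin 3 × Fin d → ℂ} (hγ : γ ∈ realizationSpace M)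
    (j : Fin d) : column γ j ≠ 0 := by
  have h : ¬ M.Dep {j} := fun h => by
    have := hM.three_le_encard h
    rw [Set.encard_singleton] at this
    exact absurd this (by decide)
  have h' := mt (hγ {j}).mpr h
  rw [not_not] at h'
  exact (linearIndepOn_singleton_iff ℂ).mp h'

theorem tri_eq_zero_iff_dep {γ : Fin 3 × Fin d → ℂ} (hγ : γ ∈ realizationSpace M) {a b c : Fin d}
    (hab : a ≠ b) (hac : a ≠ c) (hbc : b ≠ c) :
    tri (column γ a) (column γ b) (column γ c) = 0 ↔ M.Dep {a, b, c} := by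
  have h := hγ {a, b, c}
  rw [linearIndepOn_triple_iff hab hac hbc] at h
  exact (h.trans not_not).symm

theorem tri_eq_zero_of_mem_line {γ : Fin 3 × Fin d → ℂ} (hγ : γ ∈ realizationSpace M)
    {l : Set (Fin d)} (hl : IsLine M l) {a b c : Fin d} (ha : a ∈ l) (hb : b ∈ l) (hc : c ∈ l) :
    tri (column γ a) (column γ b) (column γ c) = 0 := by
  by_cases h : a ≠ b ∧ a ≠ c ∧ b ≠ c
  · exact (tri_eq_zero_iff_dep hγ h.1 h.2.1 h.2.2).mpr
      (dep_of_subset_line hl h.1 h.2.1 h.2.2 ha hb hc)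
  · exact tri_eq_zero_of_not_distinct h

/-- In a realization the intersection point of two lines through `x` is a multiple of `x`. -/
theorem exists_meetVec_eq_smul (hM : IsSimple M) {γ : Fin 3 × Fin d → ℂ}
    (hγ : γ ∈ realizationSpace M) {l₁ l₂ : Set (Fin d)} (h₁ : IsLine M l₁) (h₂ : IsLine M l₂)
    (hne : l₁ ≠ l₂) {x a b c e : Fin d} (hx₁ : x ∈ l₁) (hx₂ : x ∈ l₂) (ha : a ∈ l₁) (hb : b ∈ l₁)
    (hc : c ∈ l₂) (he : e ∈ l₂) :
    ∃ k : ℂ, meetVec (column γ a) (column γ b) (column γ c) (column γ e) = k • column γ x := by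
  obtain ⟨H₁, hH₁, hl₁⟩ := exists_plane_of_tri (γ := column γ) fun a ha b hb c hc =>
    tri_eq_zero_of_mem_line hγ h₁ ha hb hc
  obtain ⟨H₂, hH₂, hl₂⟩ := exists_plane_of_tri (γ := column γ) fun a ha b hb c hc =>
    tri_eq_zero_of_mem_line hγ h₂ ha hb hc
  -- If the planes coincided, all triples in `l₁ ∪ l₂` would be dependent, and maximality of both
  -- lines would force `l₁ = l₂`.
  have hcross : H₁ ⨯₃ H₂ ≠ 0 := by
    intro h0
    obtain ⟨k, hk⟩ := exists_smul_of_cross_eq_zero hH₁ h0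
    have hk0 : k ≠ 0 := by rintro rfl; simp at hk; exact hH₂ hk
    have hall : ∀ y ∈ l₁ ∪ l₂, H₁ ⬝ᵥ column γ y = 0 := by
      rintro y (hy | hy)
      · exact hl₁ y hy
      · have := hl₂ y hy
        rw [hk, smul_dotProduct, smul_eq_mul] at this
        exact (mul_eq_zero.mp this).resolve_left hk0
    obtain ⟨l, hl, hsub⟩ := exists_isLine_superset (s := l₁ ∪ l₂)
      (h₁.dep.superset Set.subset_union_left
        (Set.union_subset h₁.subset_ground h₂.subset_ground)) (by
        intro t ht h3
        obtain ⟨p, q, r, hpq, hpr, hqr, rfl⟩ := Set.encard_eq_three.mp h3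
        rw [← tri_eq_zero_iff_dep hγ hpq hpr hqr]
        exact tri_eq_zero_of_orth hH₁ (hall p (ht (by simp))) (hall q (ht (by simp)))
          (hall r (ht (by simp))))
    have e₁ := (Set.subset_union_left.trans hsub).antisymm
      (h₁.2 hl.prop (Set.subset_union_left.trans hsub))
    have e₂ := (Set.subset_union_right.trans hsub).antisymm
      (h₂.2 hl.prop (Set.subset_union_right.trans hsub))
    exact hne (e₁.trans e₂.symm)
  obtain ⟨k, hk⟩ := exists_smul_cross_of_orth hcross
    (dot_meetVec_left H₁ _ _ (column γ c) (column γ e) (hl₁ a ha) (hl₁ b hb))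
    (dot_meetVec_right H₂ (column γ a) (column γ b) _ _ (hl₂ c hc) (hl₂ e he))
  obtain ⟨m, hm⟩ := exists_smul_cross_of_orth hcross (hl₁ x hx₁) (hl₂ x hx₂)
  have hm0 : m ≠ 0 := by
    rintro rfl
    rw [zero_smul] at hm
    exact column_ne_zero hM hγ x hm
  refine ⟨k / m, ?_⟩
  rw [hk, hm, smul_smul, div_mul_cancel₀ _ hm0]

theorem meetVec_smul (k₁ k₂ k₃ k₄ : ℂ) (a b c e : Vec3) :
    meetVec (k₁ • a) (k₂ • b) (k₃ • c) (k₄ • e) = (k₁ * k₂ * k₃ * k₄) • meetVec a b c e := by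
  refine vec3_ext ?_ ?_ ?_ <;>
  simp only [meetVec, tri_expand, Pi.sub_apply, Pi.smul_apply, smul_eq_mul] <;> ring

theorem tri_smul (k₁ k₂ k₃ : ℂ) (a b c : Vec3) :
    tri (k₁ • a) (k₂ • b) (k₃ • c) = (k₁ * k₂ * k₃) * tri a b c := by
  simp only [tri_expand, Pi.smul_apply, smul_eq_mul]; ring

/-- Rescale the columns of a matrix. -/
def scale (m : Fin d → ℂ) (γ : Fin 3 × Fin d → ℂ) : Fin 3 × Fin d → ℂ := fun v => m v.2 * γ v

theorem column_scale (m : Fin d → ℂ) (γ : Fin 3 × Fin d → ℂ) (j : Fin d) :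
    column (scale m γ) j = m j • column γ j := rfl

/-- The induction needs arbitrary rescalings `m`, because evaluating a modification at a rescaled
realization gives another rescaling of it. -/
theorem aeval_grassmannCayleySet_eq_zero (hM : IsSimple M) {γ : Fin 3 × Fin d → ℂ}
    (hγ : γ ∈ realizationSpace M) (j : ℕ) : ∀ P ∈ grassmannCayleySet M j, ∀ m : Fin d → ℂ,
      aeval (scale m γ) P = 0 := by
  induction j with
  | zero =>
    rintro P ⟨a, b, c, hab, hbc, hC, rfl⟩ m
    rw [aeval_bracket, column_scale, column_scale, column_scale, tri_smul,
      (tri_eq_zero_iff_dep hγ hab.ne (hab.trans hbc).ne hbc.ne).mpr hC.dep, mul_zero]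
  | succ j ih =>
    rintro _ ⟨Q, hQ, σ, hσ, rfl⟩ m
    have key : ∀ x, ∃ k : ℂ, ∀ i, aeval (scale m γ) (σ x i) = k * γ (i, x) := by
      intro x
      rcases hσ x with h | ⟨l₁, l₂, h₁, h₂, hne, hx₁, hx₂, a, b, c, e, ha, hb, hc, he, h⟩
      · refine ⟨m x, fun i => ?_⟩
        rw [h]
        simp [genericMatrix, scale]
      · obtain ⟨k, hk⟩ := exists_meetVec_eq_smul hM hγ h₁ h₂ hne hx₁ hx₂ ha hb hc he
        refine ⟨m a * m b * m c * m e * k, fun i => ?_⟩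
        rw [h, aeval_meet, column_scale, column_scale, column_scale, column_scale, meetVec_smul, hk,
          smul_smul]
        rfl
    choose k hk using key
    rw [aeval_bind₁]
    have : (fun v : Fin 3 × Fin d => aeval (scale m γ) (σ v.2 v.1)) = scale k γ :=
      funext fun v => hk v.2 v.1
    rw [this]
    exact ih Q hQ k

theorem aeval_minor_eq_zero {γ : Fin 3 × Fin d → ℂ} (hγ : γ ∈ realizationSpace M) {k : ℕ}
    (A : Fin k ↪o Fin 3) (B : Fin k ↪o Fin d) (hB : M.Dep (Set.range B)) :
    aeval γ ((genericMatrix d).submatrix A B).det = 0 := by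
  rw [AlgHom.map_det, ← Matrix.exists_mulVec_eq_zero_iff]
  have h := (hγ _).mp hB
  rw [linearIndepOn_range_iff B.injective, Fintype.not_linearIndependent_iff] at h
  obtain ⟨g, hg, i, hi⟩ := h
  refine ⟨g, Function.ne_iff.mpr ⟨i, hi⟩, funext fun r => ?_⟩
  have := congrFun hg (A r)
  simp only [Finset.sum_apply, Pi.smul_apply, Function.comp_apply, smul_eq_mul,
    Pi.zero_apply] at this
  rw [Pi.zero_apply, ← this, Matrix.mulVec, dotProduct]
  refine Finset.sum_congr rfl fun j _ => ?_
  simp [genericMatrix, mul_comm]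

theorem ideal_le_vanishingIdeal (hM : IsSimple M) :
    circuitIdeal M ⊔ grassmannCayleyIdeal M ≤ vanishingIdeal ℂ (realizationSpace M) := by
  refine sup_le ?_ (iSup_le fun j => ?_)
  · refine Ideal.span_le.mpr ?_
    rintro _ ⟨k, A, B, hB, rfl⟩ γ hγ
    exact aeval_minor_eq_zero hγ A B hB.dep
  · refine Ideal.span_le.mpr fun P hP γ hγ => ?_
    have := aeval_grassmannCayleySet_eq_zero hM hγ j P hP 1
    rwa [show scale 1 γ = γ from funext fun v => one_mul _] at this

/-! ### Zeros of the Grassmann–Cayley polynomials -/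

/-- All Grassmann–Cayley polynomials vanish at `γ`. -/
def IsGrassmannCayleyZero (M : Matroid (Fin d)) (γ : Fin 3 × Fin d → ℂ) : Prop :=
  ∀ j, ∀ P ∈ grassmannCayleySet M j, aeval γ P = 0

theorem isCircuit_of_subset_line (hM : IsSimple M) {l : Set (Fin d)} (hl : IsLine M l)
    {a b c : Fin d} (hab : a ≠ b) (hac : a ≠ c) (hbc : b ≠ c) (ha : a ∈ l) (hb : b ∈ l)
    (hc : c ∈ l) : M.IsCircuit {a, b, c} := by
  obtain ⟨C, hC, hCc⟩ := (dep_of_subset_line hl hab hac hbc ha hb hc).exists_isCircuit_subset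
  have e : C = {a, b, c} := (Set.toFinite C).eq_of_subset_of_encard_le hC (by
    rw [Set.encard_eq_three.mpr ⟨a, b, c, hab, hac, hbc, rfl⟩]
    exact hM.three_le_encard hCc.dep)
  rwa [← e]

theorem IsGrassmannCayleyZero.tri_eq_zero (hM : IsSimple M) {γ : Fin 3 × Fin d → ℂ}
    (hγ : IsGrassmannCayleyZero M γ) {l : Set (Fin d)} (hl : IsLine M l) :
    ∀ a ∈ l, ∀ b ∈ l, ∀ c ∈ l, tri (column γ a) (column γ b) (column γ c) = 0 := by
  have key : ∀ a ∈ l, ∀ b ∈ l, ∀ c ∈ l, a < b → b < c →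
      tri (column γ a) (column γ b) (column γ c) = 0 := by
    intro a ha b hb c hc hab hbc
    rw [← aeval_bracket]
    exact hγ 0 _ ⟨a, b, c, hab, hbc, isCircuit_of_subset_line hM hl hab.ne (hab.trans hbc).ne
      hbc.ne ha hb hc, rfl⟩
  intro a ha b hb c hc
  by_cases h : a ≠ b ∧ a ≠ c ∧ b ≠ c
  swap
  · exact tri_eq_zero_of_not_distinct h
  rcases lt_or_gt_of_ne h.1 with h1 | h1 <;> rcases lt_or_gt_of_ne h.2.1 with h2 | h2 <;>
  rcases lt_or_gt_of_ne h.2.2 with h3 | h3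
  · exact key a ha b hb c hc h1 h3
  · rw [← neg_eq_zero, ← tri_swap]; exact key a ha c hc b hb h2 h3
  · exact absurd (h1.trans h3) h2.not_gt
  · rw [tri_rotate, tri_rotate]; exact key c hc a ha b hb h2 h1
  · rw [← neg_eq_zero, ← tri_swap_left]; exact key b hb a ha c hc h1 h2
  · exact absurd (h3.trans h1) h2.not_gt
  · rw [tri_rotate]; exact key b hb c hc a ha h3 h2
  · rw [tri_rotate, ← neg_eq_zero, ← tri_swap_left]; exact key c hc b hb a ha h3 h1

/-- The modifications of `X_j` belong to `X_{j+1}`, so a vanishing condition imposed for all `j`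
passes to modified points. -/
theorem IsGrassmannCayleyZero.modification {γ : Fin 3 × Fin d → ℂ}
    (hγ : IsGrassmannCayleyZero M γ) {σ : Fin d → Fin 3 → Poly d} (hσ : IsModification M σ) :
    IsGrassmannCayleyZero M fun v => aeval γ (σ v.2 v.1) := by
  intro j P hP
  rw [← aeval_bind₁]
  exact hγ (j + 1) _ ⟨P, hP, σ, hσ, rfl⟩

/-- Zero columns that are determined by two lines can be filled in. -/
theorem IsGrassmannCayleyZero.exists_isSaturated (hM : IsSimple M) (n : ℕ) :
    ∀ γ : Fin 3 × Fin d → ℂ, IsGrassmannCayleyZero M γ → {x | column γ x = 0}.ncard = n →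
      ∃ γ' : Fin 3 × Fin d → ℂ, (∀ x, column γ x ≠ 0 → column γ' x = column γ x) ∧
        IsSaturated M (column γ') := by
  classical
  induction n using Nat.strong_induction_on with
  | _ n ih =>
    intro γ hγ hn
    by_cases hs : IsSaturated M (column γ)
    · exact ⟨γ, fun _ _ => rfl, hs⟩
    have hs' := mt (fun h => (⟨fun l hl => hγ.tri_eq_zero hM hl, h⟩ : IsSaturated M (column γ))) hs
    push Not at hs'
    obtain ⟨x, hx, l₁, l₂, h₁, h₂, hne, hx₁, hx₂, a, ha, b, hb, c, hc, e, he, hm⟩ := hs'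
    -- Only the zero column `x` is replaced, by a nonzero meet, so the number of zero columns drops.
    let σ : Fin d → Fin 3 → Poly d := fun y =>
      if y = x then meet a b c e else fun i => genericMatrix d i y
    have hσ : IsModification M σ := by
      intro y
      by_cases hy : y = x
      · subst hy
        exact Or.inr ⟨l₁, l₂, h₁, h₂, hne, hx₁, hx₂, a, b, c, e, ha, hb, hc, he, if_pos rfl⟩
      · exact Or.inl (if_neg hy)
    set γ₁ : Fin 3 × Fin d → ℂ := fun v => aeval γ (σ v.2 v.1) with hγ₁
    have hx' : column γ₁ x ≠ 0 := by
      have : column γ₁ x = meetVec (column γ a) (column γ b) (column γ c) (column γ e) := by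
        funext i
        simp only [column, hγ₁, σ, if_pos]
        exact aeval_meet γ a b c e i
      rwa [this]
    have hy' : ∀ y ≠ x, column γ₁ y = column γ y := by
      intro y hy
      funext i
      simp [column, hγ₁, σ, hy, genericMatrix]
    have hsub : {y | column γ₁ y = 0} ⊂ {y | column γ y = 0} := by
      refine Set.ssubset_iff_exists.mpr ⟨fun y hy => ?_, x, hx, hx'⟩
      by_cases hyx : y = x
      · subst hyx; exact hx
      · exact (hy' y hyx).symm.trans hy
    obtain ⟨γ', h1, h2⟩ := ih _ (hn ▸ Set.ncard_lt_ncard hsub (Set.toFinite _)) γ₁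
      (hγ.modification hσ) rfl
    refine ⟨γ', fun y hy => ?_, h2⟩
    have hyx : y ≠ x := by rintro rfl; exact hy hx
    rw [← hy' y hyx] at hy ⊢
    exact h1 y hy

/-! ### Matroid ideals of cactus configurations -/

theorem smul_mem_gen {α : Type*} {E : Set α} {L : Set (Set α)} {c : Config α} (hc : c ∈ Gen E L)
    {m : α → ℂ} (hm : ∀ x, m x ≠ 0) : ((fun x => m x • c.1 x, c.2) : Config α) ∈ Gen E L := by
  obtain ⟨⟨i1, i2, i3⟩, g1, g2, g3⟩ := hc
  refine ⟨⟨fun x hx => smul_ne_zero (hm x) (i1 x hx), i2, fun l hl x hx hxl => ?_⟩,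
    fun x hx y hy hxy => ?_, fun x hx y hy z hz h1 h2 h3 h4 => ?_, fun x hx l hl hxl => ?_⟩
  · simp only [dotProduct_smul, i3 l hl x hx hxl, smul_zero]
  · simp only [map_smul, LinearMap.smul_apply]
    exact smul_ne_zero (hm y) (smul_ne_zero (hm x) (g1 x hx y hy hxy))
  · simp only [tri_smul]
    exact mul_ne_zero (mul_ne_zero (mul_ne_zero (hm x) (hm y)) (hm z))
      (g2 x hx y hy z hz h1 h2 h3 h4)
  · simp only [dotProduct_smul]
    exact smul_ne_zero (hm x) (g3 x hx l hl hxl)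

/-- Polynomials vanishing on the realization space vanish on all rescalings of limits of generic
configurations. -/
theorem aeval_eq_zero_of_mem_closure_gen (hE : M.E = Set.univ) (hM : IsSimple M)
    (hr : M.eRank ≤ 3) {c : Config (Fin d)} (hc : c ∈ closure (Gen Set.univ {l | IsLine M l}))
    {f : Poly d} (hf : f ∈ vanishingIdeal ℂ (realizationSpace M)) (m : Fin d → ℂ) :
    aeval (fun v : Fin 3 × Fin d => m v.2 * c.1 v.2 v.1) f = 0 := by
  have hcont : Continuous fun x : Fin 3 × Fin d → ℂ => aeval x f := by
    simp only [aeval_eq_eval]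
    exact f.continuous_eval
  have h1 : ∀ c ∈ Gen Set.univ {l | IsLine M l},
      aeval (fun v : Fin 3 × Fin d => m v.2 * c.1 v.2 v.1) f = 0 := by
    intro c hc
    -- Nowhere zero scalings keep the configuration generic and are dense; the others are reached by
    -- continuity.
    have hres : ∀ᶠ m in residual (Fin d → ℂ), ∀ x, m x ≠ 0 := by
      refine Filter.eventually_all.mpr fun x => ?_
      exact residual_ne_zero (F := fun m : Fin d → ℂ => m x) (by fun_prop) ⟨1, one_ne_zero⟩
    have hcl : IsClosed {m : Fin d → ℂ |
        aeval (fun v : Fin 3 × Fin d => m v.2 * c.1 v.2 v.1) f = 0} :=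
      isClosed_eq (hcont.comp (by fun_prop)) continuous_const
    refine closure_minimal ?_ hcl (dense_of_mem_residual hres m)
    intro m hm
    exact hf _ (mem_realizationSpace_of_gen hE hM hr (smul_mem_gen hc hm) fun j => rfl)
  have hcl : IsClosed {c : Config (Fin d) |
      aeval (fun v : Fin 3 × Fin d => m v.2 * c.1 v.2 v.1) f = 0} :=
    isClosed_eq (hcont.comp (by fun_prop)) continuous_const
  exact closure_minimal h1 hcl hc

theorem vanishingIdeal_le (hE : M.E = Set.univ) (hM : IsCactus M)
    (hQ : ¬ ContainsCycle M (pointsOfDegreeGeThree M)) :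
    vanishingIdeal ℂ (realizationSpace M) ≤
      vanishingIdeal ℂ (zeroLocus ℂ (circuitIdeal M ⊔ grassmannCayleyIdeal M)) := by
  intro f hf γ hγ
  have hγ0 : IsGrassmannCayleyZero M γ := fun j P hP =>
    hγ P (Ideal.mem_sup_right (Ideal.mem_iSup_of_mem j (Ideal.subset_span hP)))
  obtain ⟨γ', hγ', hs⟩ := IsGrassmannCayleyZero.exists_isSaturated hM.1 _ γ hγ0 rfl
  obtain ⟨c, hc, hm⟩ := hs.exists_inc hQ
  have hflex := hM.flexible
  rw [hE] at hflex
  have hm' : ∀ x, ∃ k : ℂ, column γ x = k • c.1 x := by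
    intro x
    -- A column filled in during saturation is turned back to zero by the factor `0`.
    by_cases hx : column γ x = 0
    · exact ⟨0, by rw [hx, zero_smul]⟩
    · rw [← hγ' x hx]; exact hm x
  choose k hk using hm'
  have e : γ = fun v : Fin 3 × Fin d => k v.2 * c.1 v.2 v.1 :=
    funext fun v => congrFun (hk v.2) v.1
  rw [e]
  exact aeval_eq_zero_of_mem_closure_gen hE hM.1 hM.2.1 (hflex hc) hf k

end Evaluation
end CactusMatroid

/-- The Nullstellensatz turns the radical into the vanishing ideal of the common zeros; the closure
in the definition of `V_M` does not affect the comparison with `Γ_M`. -/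
theorem mainTheorem3 (d : ℕ) (M : Matroid (Fin d)) (hE : M.E = Set.univ)
    (hM : CactusMatroid.IsCactus M)
    (hQ : ¬ CactusMatroid.ContainsCycle M (CactusMatroid.pointsOfDegreeGeThree M)) :
    CactusMatroid.matroidIdeal M =
      (CactusMatroid.circuitIdeal M ⊔ CactusMatroid.grassmannCayleyIdeal M).radical := by
  refine Eq.trans ?_ (MvPolynomial.vanishingIdeal_zeroLocus_eq_radical (K := ℂ)
    (CactusMatroid.circuitIdeal M ⊔ CactusMatroid.grassmannCayleyIdeal M))
  rw [CactusMatroid.matroidIdeal, CactusMatroid.matroidVariety]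
  refine le_antisymm ?_ ?_
  · exact (MvPolynomial.vanishingIdeal_anti_mono
      (MvPolynomial.zeroLocus_vanishingIdeal_le _)).trans (CactusMatroid.vanishingIdeal_le hE hM hQ)
  · exact MvPolynomial.vanishingIdeal_anti_mono
      (MvPolynomial.zeroLocus_anti_mono (CactusMatroid.ideal_le_vanishingIdeal hM.1))
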